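/- Let $\tilde\ell\colon\mathbb{R}_{\ge 0}\to\mathbb{R}_{\ge 0}$ be a concave function and let $\ell(\hat y,y)=\tilde\ell(|\hat y-y|)$. For integers $n,d,k\ge 1$ and data points $(\mathbf{x}_1,y_1),\dots,(\mathbf{x}_n,y_n)\in\mathbb{R}^d\times\mathbb{R}$, the problem $k$-ReLU($\ell$) asks for weight vectors $\mathbf{w}_1,\dots,\mathbf{w}_k\in\mathbb{R}^d$, biases $b_1,\dots,b_k\in\mathbb{R}$ and coefficients $a_1,\dots,a_k\in\{-1,1\}$ that minimize \[ \sum_{i=1}^n \ell\Bigl(\sum_{j=1}^k a_j\max(0,\langle\mathbf{w}_j,\mathbf{x}_i\rangle+b_j),\ y_i\Bigr); \] its decision version asks, for an additionally given $\gamma\in\mathbb{R}$, whether a value of at most $\gamma$ can be achieved. Time is measured as the number of steps of a real RAM, on which arithmetic operations and comparisons of real numbers and evaluations of $\ell$ have unit cost. Then a minimizer exists for all data, and there are a constant $C$ and a polynomial $q$ such that the optimization problem and the decision problem are each solved by a single algorithm (which receives $n$, $d$, $k$ and the data) in time at most $2^k\,(nk)^{C\,dk}\,q(n,d,k)$ for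 all $n,d,k\ge 1$; that is, $k$-ReLU($\ell$) is solvable in time $2^k(nk)^{O(dk)}\,\mathrm{poly}(n,d,k)$. In particular, this holds for the $\ell^p$-loss $\ell(\hat y,y)=|\hat y-y|^p$ for every $p\in(0,1)$, and for the $\ell^0$-loss, which is $0$ if $\hat y=y$ and $1$ otherwise. -/

import Mathlib

namespace ReLUTraining

/-! ## The training problem -/

/-- The parameters of a two-layer ReLU network with `d` inputs and `k` hidden neurons: weight
vectors, biases, and output coefficients in `{-1, 1}`. -/
structure Params (d k : ℕ) where
  w : Fin k → Fin d → ℝ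
  b : Fin k → ℝ
  a : Fin k → ℝ
  sign : ∀ j, a j = -1 ∨ a j = 1

/-- The function `x ↦ ∑ j, a j * [⟨w j, x⟩ + b j]₊` computed by the network. -/
def Params.predict {d k : ℕ} (θ : Params d k) (x : Fin d → ℝ) : ℝ :=
  ∑ j, θ.a j * max 0 ((∑ l, θ.w j l * x l) + θ.b j)

/-- The training error of the network on the data points `(x i, y i)` for the loss `L ŷ y`. -/
def trainingError (L : ℝ → ℝ → ℝ) {n d k : ℕ} (x : Fin n → Fin d → ℝ) (y : Fin n → ℝ)
    (θ : Params d k) : ℝ :=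
  ∑ i, L (θ.predict (x i)) (y i)

/-- The loss `|ŷ - y| ^ p` for `p > 0`; for `p = 0` it is `1` on the points that are not
perfectly fitted and `0` on those that are. -/
noncomputable def lpLoss (p : ℝ) (yhat y : ℝ) : ℝ :=
  if p = 0 then (if yhat = y then 0 else 1) else |yhat - y| ^ p

/-! ## The real RAM

Programs are while-programs over two kinds of unbounded memory: memory for natural numbers (used
for counting and for addresses) and memory for real numbers. Each kind is divided into banks; the
bank is named by the program, the address inside it is computed. All operations have unit cost.
Naturals can be added, subtracted (truncated at zero) and compared; reals can be added,
subtracted, multiplied, divided and compared, and the loss function can be evaluated. There is no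
rounding and no way to turn a real number into a natural one other than by comparisons, and the
only constants are natural numbers. -/

/-- The contents of the memory: `natMem m i` and `realMem m i` are the cells with address `i` of
the bank `m`. -/
structure State where
  natMem : ℕ → ℕ → ℕ
  realMem : ℕ → ℕ → ℝ

/-- Replace the content of one natural-number cell. -/
def State.setNat (s : State) (m i v : ℕ) : State :=
  { s with natMem := Function.update s.natMem m (Function.update (s.natMem m) i v) }

/-- Replace the content of one real-number cell. -/
noncomputable def State.setReal (s : State) (m i : ℕ) (v : ℝ) : State :=
  { s with realMem := Function.update s.realMem m (Function.update (s.realMem m) i v) }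

/-- Expressions with natural values. -/
inductive NatExpr where
  | const (c : ℕ)
  | read (bank : ℕ) (addr : NatExpr)
  | add (e f : NatExpr)
  | sub (e f : NatExpr)

def NatExpr.eval (s : State) : NatExpr → ℕ
  | const c => c
  | read m e => s.natMem m (e.eval s)
  | add e f => e.eval s + f.eval s
  | sub e f => e.eval s - f.eval s

/-- The number of operations in an expression. -/
def NatExpr.cost : NatExpr → ℕ
  | const _ => 1
  | read _ e => e.cost + 1
  | add e f => e.cost + f.cost + 1
  | sub e f => e.cost + f.cost + 1

/-- Expressions with real values; `loss e f` is a call of the loss function. -/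
inductive RealExpr where
  | const (c : ℕ)
  | read (bank : ℕ) (addr : NatExpr)
  | add (e f : RealExpr)
  | sub (e f : RealExpr)
  | mul (e f : RealExpr)
  | div (e f : RealExpr)
  | loss (e f : RealExpr)

/-- The value of a real expression; a division by zero gives zero. -/
noncomputable def RealExpr.eval (L : ℝ → ℝ → ℝ) (s : State) : RealExpr → ℝ
  | const c => (c : ℝ)
  | read m e => s.realMem m (e.eval s)
  | add e f => e.eval L s + f.eval L s
  | sub e f => e.eval L s - f.eval L s
  | mul e f => e.eval L s * f.eval L s
  | div e f => e.eval L s / f.eval L s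
  | loss e f => L (e.eval L s) (f.eval L s)

/-- The number of operations in an expression. -/
def RealExpr.cost : RealExpr → ℕ
  | const _ => 1
  | read _ e => e.cost + 1
  | add e f => e.cost + f.cost + 1
  | sub e f => e.cost + f.cost + 1
  | mul e f => e.cost + f.cost + 1
  | div e f => e.cost + f.cost + 1
  | loss e f => e.cost + f.cost + 1

/-- Tests. -/
inductive Test where
  | natLe (e f : NatExpr)
  | realLe (e f : RealExpr)
  | not (t : Test)
  | and (t u : Test)

def Test.Holds (L : ℝ → ℝ → ℝ) (s : State) : Test → Prop
  | natLe e f => e.eval s ≤ f.eval s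
  | realLe e f => e.eval L s ≤ f.eval L s
  | not t => ¬ t.Holds L s
  | and t u => t.Holds L s ∧ u.Holds L s

/-- The number of operations in a test. -/
def Test.cost : Test → ℕ
  | natLe e f => e.cost + f.cost + 1
  | realLe e f => e.cost + f.cost + 1
  | not t => t.cost + 1
  | and t u => t.cost + u.cost + 1

/-- Programs. A program is a finite object that is independent of the input. -/
inductive Program where
  | skip
  | storeNat (bank : ℕ) (addr val : NatExpr)
  | storeReal (bank : ℕ) (addr : NatExpr) (val : RealExpr)
  | seq (c₁ c₂ : Program)
  | cond (t : Test) (c₁ c₂ : Program)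
  | loop (t : Test) (c : Program)

/-- `Exec L c s T s'`: started in the state `s`, the program `c` halts after exactly `T` steps,
in the state `s'`. The program `loop t c` repeats `c` as long as the test `t` holds. -/
inductive Exec (L : ℝ → ℝ → ℝ) : Program → State → ℕ → State → Prop where
  | skip (s : State) : Exec L .skip s 1 s
  | storeNat (m : ℕ) (e f : NatExpr) (s : State) :
      Exec L (.storeNat m e f) s (e.cost + f.cost + 1) (s.setNat m (e.eval s) (f.eval s))
  | storeReal (m : ℕ) (e : NatExpr) (f : RealExpr) (s : State) :
      Exec L (.storeReal m e f) s (e.cost + f.cost + 1) (s.setReal m (e.eval s) (f.eval L s))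
  | seq {c₁ c₂ : Program} {s₁ s₂ s₃ : State} {T₁ T₂ : ℕ} :
      Exec L c₁ s₁ T₁ s₂ → Exec L c₂ s₂ T₂ s₃ → Exec L (.seq c₁ c₂) s₁ (T₁ + T₂) s₃
  | condTrue {t : Test} {c₁ c₂ : Program} {s s' : State} {T : ℕ} :
      t.Holds L s → Exec L c₁ s T s' → Exec L (.cond t c₁ c₂) s (t.cost + T + 1) s'
  | condFalse {t : Test} {c₁ c₂ : Program} {s s' : State} {T : ℕ} :
      ¬ t.Holds L s → Exec L c₂ s T s' → Exec L (.cond t c₁ c₂) s (t.cost + T + 1) s'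
  | loopDone {t : Test} {c : Program} {s : State} :
      ¬ t.Holds L s → Exec L (.loop t c) s (t.cost + 1) s
  | loopStep {t : Test} {c : Program} {s₁ s₂ s₃ : State} {T₁ T₂ : ℕ} :
      t.Holds L s₁ → Exec L c s₁ T₁ s₂ → Exec L (.loop t c) s₂ T₂ s₃ →
      Exec L (.loop t c) s₁ (t.cost + T₁ + T₂ + 1) s₃

/-! ## Input, output and solvability -/

/-- The initial state. Cells `0` of the natural banks `0`, `1`, `2` hold `n`, `d`, `k`; the real
bank `0` holds the matrix of the points `x i` row by row (`x i l` at the address `i * d + l`), the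
real bank `1` holds the labels, and cell `0` of the real bank `2` holds the target error. All
other cells are zero. -/
noncomputable def inputState {n d : ℕ} (k : ℕ) (x : Fin n → Fin d → ℝ) (y : Fin n → ℝ) (γ : ℝ) :
    State where
  natMem m i :=
    if i = 0 then (if m = 0 then n else if m = 1 then d else if m = 2 then k else 0) else 0
  realMem m i :=
    if m = 0 then
      (if h : i < n * d then
        x (finProdFinEquiv.symm ⟨i, h⟩).1 (finProdFinEquiv.symm ⟨i, h⟩).2 else 0)
    else if m = 1 then (if h : i < n then y ⟨i, h⟩ else 0)
    else if m = 2 then (if i = 0 then γ else 0)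
    else 0

/-- The state holds the parameters `θ` as output: the weights in the real bank `3` (`w j l` at the
address `j * d + l`), the biases in the real bank `4`, the coefficients in the real bank `5`. -/
def State.HoldsParams (s : State) {d k : ℕ} (θ : Params d k) : Prop :=
  (∀ (j : Fin k) (l : Fin d), s.realMem 3 (j * d + l) = θ.w j l) ∧
  (∀ j : Fin k, s.realMem 4 j = θ.b j) ∧
  (∀ j : Fin k, s.realMem 5 j = θ.a j)

/-- One program, which gets `n`, `d`, `k` and the data points, finds parameters of minimum
training error within `T n d k` steps. -/
def TrainingSolvableInTime (L : ℝ → ℝ → ℝ) (T : ℕ → ℕ → ℕ → ℕ) : Prop :=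
  ∃ c : Program, ∀ n d k : ℕ, 1 ≤ n → 1 ≤ d → 1 ≤ k →
    ∀ (x : Fin n → Fin d → ℝ) (y : Fin n → ℝ),
      ∃ (t : ℕ) (s : State), Exec L c (inputState k x y 0) t s ∧ t ≤ T n d k ∧
        ∃ θ : Params d k, s.HoldsParams θ ∧
          ∀ θ' : Params d k, trainingError L x y θ ≤ trainingError L x y θ'

/-- One program, which gets `n`, `d`, `k`, the data points and a target error `γ`, decides within
`T n d k` steps whether a training error of at most `γ` can be achieved; the answer, `1` for yes
and `0` for no, is in cell `0` of the natural bank `3`. -/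
def TrainingDecidableInTime (L : ℝ → ℝ → ℝ) (T : ℕ → ℕ → ℕ → ℕ) : Prop :=
  ∃ c : Program, ∀ n d k : ℕ, 1 ≤ n → 1 ≤ d → 1 ≤ k →
    ∀ (x : Fin n → Fin d → ℝ) (y : Fin n → ℝ) (γ : ℝ),
      ∃ (t : ℕ) (s : State), Exec L c (inputState k x y γ) t s ∧ t ≤ T n d k ∧
        (s.natMem 3 0 = 0 ∨ s.natMem 3 0 = 1) ∧
        (s.natMem 3 0 = 1 ↔ ∃ θ : Params d k, trainingError L x y θ ≤ γ)

/-- The optimization problem and the decision problem can both be solved in time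
`2 ^ k * (n * k) ^ O(d * k) * poly(n, d, k)`. -/
def SolvableInXPTime (L : ℝ → ℝ → ℝ) : Prop :=
  ∃ (C : ℕ) (q : MvPolynomial (Fin 3) ℕ),
    TrainingSolvableInTime L
      (fun n d k => 2 ^ k * (n * k) ^ (C * (d * k)) * MvPolynomial.eval ![n, d, k] q) ∧
    TrainingDecidableInTime L
      (fun n d k => 2 ^ k * (n * k) ^ (C * (d * k)) * MvPolynomial.eval ![n, d, k] q)

end ReLUTraining

/-! Fix the output signs, the set of active neurons at every data point, and the sign of every
residual. On the polyhedron of weights cut out by these choices the network output at each point is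
linear in the weights and the absolute residuals are affine, so the training error is a sum of
concave functions of affine ones: it is concave and nonnegative. From any point of a polyhedron, a
concave function bounded below can be made no larger by passing to a point whose tight constraints
span all constraints (`exists_tight_span`). The values of all constraints, hence the error, are then
determined by the tight ones, each of which says that some neuron has input 0 at some point or that
some point is fitted exactly. Their rank is at most `k * min n (d + 1)` (`finrank_span_le`), so that
many equations suffice (`exists_fit_equations`).

A fitting equation can only be written down once the activation pattern is known. The pattern is
guessed in the same way: scaling the weights and raising the biases turns it into inequalities `±
input ≥ 1`, and a point whose tight constraints span everything is again pinned down by few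
equations `± input = 1` (`exists_pattern_equations`). So every network is matched by one of finitely
many candidates, each encoded by two lists of equations and a list of signs (`exists_digits`). A
best candidate is therefore a minimizer, which also settles existence. Wrong guesses are harmless
because each candidate is judged by its actual training error.

The program runs through all encodings, read as numbers in base `2 * n * k`, and solves the linear
systems by successive orthogonal projections (`IsProjection.step`, `IsProjection.solution`), which
need no rank test. Time is estimated crudely: every loop is repeated at most `V` times, where `V` is
the number of candidates times a polynomial, and the time is at most `a * V ^ p` with `a` and `p`
depending on the program alone (`Program.exists_time_le`). The power `p` is absorbed by the constant
in the exponent. -/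

namespace ReLUTraining

/-! ## Running time and memory footprint of programs -/

/-- The banks of natural numbers that a program may write to. -/
def Program.natW : Program → List ℕ
  | skip => []
  | storeNat m _ _ => [m]
  | storeReal _ _ _ => []
  | seq c₁ c₂ => c₁.natW ++ c₂.natW
  | cond _ c₁ c₂ => c₁.natW ++ c₂.natW
  | loop _ c => c.natW

/-- The banks of real numbers that a program may write to. -/
def Program.realW : Program → List ℕ
  | skip => []
  | storeNat _ _ _ => []
  | storeReal m _ _ => [m]
  | seq c₁ c₂ => c₁.realW ++ c₂.realW
  | cond _ c₁ c₂ => c₁.realW ++ c₂.realW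
  | loop _ c => c.realW

/-- The running time of a program none of whose loops is repeated more than `V` times. -/
def Program.time (V : ℕ) : Program → ℕ
  | skip => 1
  | storeNat _ e f => e.cost + f.cost + 1
  | storeReal _ e f => e.cost + f.cost + 1
  | seq c₁ c₂ => c₁.time V + c₂.time V
  | cond t c₁ c₂ => t.cost + (c₁.time V + c₂.time V) + 1
  | loop t c => V * (t.cost + c.time V + 1) + (t.cost + 1)

/-- `V` enters only as a factor for each loop. The exponent obtained is the total number of loops
rather than the nesting depth; only its independence of the input matters. -/
theorem Program.exists_time_le (c : Program) :
    ∃ a p : ℕ, ∀ V, 1 ≤ V → c.time V ≤ a * V ^ p := by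
  induction c with
  | skip => exact ⟨1, 0, fun V _ => by simp [time]⟩
  | storeNat m e f => exact ⟨e.cost + f.cost + 1, 0, fun V _ => by simp [time]⟩
  | storeReal m e f => exact ⟨e.cost + f.cost + 1, 0, fun V _ => by simp [time]⟩
  | seq c₁ c₂ h₁ h₂ =>
    obtain ⟨a₁, p₁, h₁⟩ := h₁
    obtain ⟨a₂, p₂, h₂⟩ := h₂
    refine ⟨a₁ + a₂, p₁ + p₂, fun V hV => ?_⟩
    have e₁ : V ^ p₁ ≤ V ^ (p₁ + p₂) := Nat.pow_le_pow_right hV (by omega)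
    have e₂ : V ^ p₂ ≤ V ^ (p₁ + p₂) := Nat.pow_le_pow_right hV (by omega)
    calc time V (seq c₁ c₂) ≤ a₁ * V ^ p₁ + a₂ * V ^ p₂ := add_le_add (h₁ V hV) (h₂ V hV)
      _ ≤ a₁ * V ^ (p₁ + p₂) + a₂ * V ^ (p₁ + p₂) := by gcongr
      _ = _ := by ring
  | cond t c₁ c₂ h₁ h₂ =>
    obtain ⟨a₁, p₁, h₁⟩ := h₁
    obtain ⟨a₂, p₂, h₂⟩ := h₂
    refine ⟨a₁ + a₂ + t.cost + 1, p₁ + p₂, fun V hV => ?_⟩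
    have e₁ : V ^ p₁ ≤ V ^ (p₁ + p₂) := Nat.pow_le_pow_right hV (by omega)
    have e₂ : V ^ p₂ ≤ V ^ (p₁ + p₂) := Nat.pow_le_pow_right hV (by omega)
    have e₃ : 1 ≤ V ^ (p₁ + p₂) := Nat.one_le_pow _ _ hV
    calc time V (cond t c₁ c₂) = time V c₁ + time V c₂ + (t.cost + 1) * 1 := by
          simp only [time]; ring
      _ ≤ a₁ * V ^ p₁ + a₂ * V ^ p₂ + (t.cost + 1) * 1 := by gcongr <;> solve_by_elim
      _ ≤ a₁ * V ^ (p₁ + p₂) + a₂ * V ^ (p₁ + p₂) + (t.cost + 1) * V ^ (p₁ + p₂) := by gcongr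
      _ = _ := by ring
  | loop t c h =>
    obtain ⟨a, p, h⟩ := h
    refine ⟨a + 2 * (t.cost + 1), p + 1, fun V hV => ?_⟩
    have e₁ : V ≤ V ^ (p + 1) := Nat.le_self_pow (by omega) V
    calc time V (loop t c) = V * time V c + (t.cost + 1) * V + (t.cost + 1) * 1 := by
          simp only [time]; ring
      _ ≤ V * (a * V ^ p) + (t.cost + 1) * V ^ (p + 1) + (t.cost + 1) * V ^ (p + 1) := by
          gcongr
          · exact h V hV
          · omega
      _ = _ := by ring

/-- The states `s` and `s'` agree on all banks outside of the two lists. -/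
def Agree (nw rw : List ℕ) (s s' : State) : Prop :=
  (∀ m, m ∉ nw → s'.natMem m = s.natMem m) ∧ ∀ m, m ∉ rw → s'.realMem m = s.realMem m

theorem Agree.refl (nw rw : List ℕ) (s : State) : Agree nw rw s s :=
  ⟨fun _ _ => rfl, fun _ _ => rfl⟩

theorem Agree.trans {nw rw nw' rw' : List ℕ} {s₁ s₂ s₃ : State} (h : Agree nw rw s₁ s₂)
    (h' : Agree nw' rw' s₂ s₃) : Agree (nw ++ nw') (rw ++ rw') s₁ s₃ := by
  constructor
  · intro m hm
    simp only [List.mem_append, not_or] at hm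
    rw [h'.1 m hm.2, h.1 m hm.1]
  · intro m hm
    simp only [List.mem_append, not_or] at hm
    rw [h'.2 m hm.2, h.2 m hm.1]

theorem Agree.mono {nw rw nw' rw' : List ℕ} {s s' : State} (h : Agree nw rw s s')
    (hn : nw ⊆ nw') (hr : rw ⊆ rw') : Agree nw' rw' s s' :=
  ⟨fun m hm => h.1 m fun h' => hm (hn h'), fun m hm => h.2 m fun h' => hm (hr h')⟩

theorem Agree.setNat (s : State) (m i v : ℕ) : Agree [m] [] s (s.setNat m i v) :=
  ⟨fun m' hm => Function.update_of_ne (by simpa using hm) _ _, fun _ _ => rfl⟩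

theorem Agree.setReal (s : State) (m i : ℕ) (v : ℝ) : Agree [] [m] s (s.setReal m i v) :=
  ⟨fun _ _ => rfl, fun m' hm => Function.update_of_ne (by simpa using hm) _ _⟩

/-- Which banks a program can write to is visible from its text. Hence almost every frame condition
in the correctness proofs is a membership question about literal bank numbers, settled by `decide`.
-/
theorem Exec.agree {L : ℝ → ℝ → ℝ} {c : Program} {s s' : State} {t : ℕ} (h : Exec L c s t s') :
    Agree c.natW c.realW s s' := by
  induction h with
  | skip s => exact .refl _ _ _
  | storeNat m e f s => exact .setNat _ _ _ _
  | storeReal m e f s => exact .setReal _ _ _ _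
  | seq _ _ h₁ h₂ => exact h₁.trans h₂
  | condTrue _ _ h => exact h.mono (by simp [Program.natW]) (by simp [Program.realW])
  | condFalse _ _ h => exact h.mono (by simp [Program.natW]) (by simp [Program.realW])
  | loopDone _ => exact .refl _ _ _
  | loopStep _ _ _ h₁ h₂ =>
    exact (h₁.trans h₂).mono (by simp [Program.natW]) (by simp [Program.realW])

/-! ## Total correctness -/

/-- Started in `s`, the program `c` halts in a state that satisfies `Q`, within the time that it
needs if none of its loops is repeated more than `V` times. -/
def Runs (V : ℕ) (L : ℝ → ℝ → ℝ) (c : Program) (s : State) (Q : State → Prop) : Prop :=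
  ∃ t s', Exec L c s t s' ∧ t ≤ c.time V ∧ Q s'

section

variable {V : ℕ} {L : ℝ → ℝ → ℝ} {c c₁ c₂ : Program} {s : State} {Q Q₁ : State → Prop}

theorem Runs.imp (h : Runs V L c s Q₁) (hQ : ∀ s', Agree c.natW c.realW s s' → Q₁ s' → Q s') :
    Runs V L c s Q := by
  obtain ⟨t, s', he, ht, hq⟩ := h
  exact ⟨t, s', he, ht, hQ s' he.agree hq⟩

theorem Runs.skip (h : Q s) : Runs V L .skip s Q := ⟨1, s, .skip s, le_rfl, h⟩

theorem Runs.storeNat {m : ℕ} {e f : NatExpr} (h : Q (s.setNat m (e.eval s) (f.eval s))) :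
    Runs V L (.storeNat m e f) s Q := ⟨_, _, .storeNat m e f s, le_rfl, h⟩

theorem Runs.storeReal {m : ℕ} {e : NatExpr} {f : RealExpr}
    (h : Q (s.setReal m (e.eval s) (f.eval L s))) :
    Runs V L (.storeReal m e f) s Q := ⟨_, _, .storeReal m e f s, le_rfl, h⟩

theorem Runs.seq (h₁ : Runs V L c₁ s Q₁)
    (h₂ : ∀ s', Agree c₁.natW c₁.realW s s' → Q₁ s' → Runs V L c₂ s' Q) :
    Runs V L (.seq c₁ c₂) s Q := by
  obtain ⟨t, s', he, ht, hq⟩ := h₁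
  obtain ⟨t', s'', he', ht', hq'⟩ := h₂ s' he.agree hq
  exact ⟨t + t', s'', .seq he he', add_le_add ht ht', hq'⟩

theorem Runs.cond {t : Test} (h₁ : t.Holds L s → Runs V L c₁ s Q)
    (h₂ : ¬ t.Holds L s → Runs V L c₂ s Q) : Runs V L (.cond t c₁ c₂) s Q := by
  by_cases h : t.Holds L s
  · obtain ⟨u, s', he, hu, hq⟩ := h₁ h
    exact ⟨_, s', .condTrue h he, by simp only [Program.time]; omega, hq⟩
  · obtain ⟨u, s', he, hu, hq⟩ := h₂ h
    exact ⟨_, s', .condFalse h he, by simp only [Program.time]; omega, hq⟩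

end

/-- The content of the cell `0` of a bank of natural numbers. -/
abbrev nv (m : ℕ) : NatExpr := .read m (.const 0)

/-- The content of the cell `0` of a bank of real numbers. -/
abbrev rv (m : ℕ) : RealExpr := .read m (.const 0)

/-- Run `body` for the values `0, …, N - 1` of the variable `v`, where `N` is the content of the
variable `b`. -/
def forLoop (v b : ℕ) (body : Program) : Program :=
  .seq (.storeNat v (.const 0) (.const 0))
    (.loop (.natLe (.add (nv v) (.const 1)) (nv b))
      (.seq body (.storeNat v (.const 0) (.add (nv v) (.const 1)))))

/-- Total correctness by induction on the number of remaining rounds. The invariant must be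
insensitive to the counter (`hI`), and the body may write neither to the counter's bank nor to the
bound's. -/
theorem Runs.forLoop {V : ℕ} {L : ℝ → ℝ → ℝ} {v b N : ℕ} {body : Program} {s : State}
    (Inv : ℕ → State → Prop) (hv : v ∉ body.natW) (hb : b ∉ v :: body.natW)
    (hN : s.natMem b 0 = N) (hNV : N ≤ V)
    (hI : ∀ i s' x, Inv i s' → Inv i (s'.setNat v 0 x)) (h0 : Inv 0 s)
    (hstep : ∀ i, i < N → ∀ s', Agree (v :: body.natW) body.realW s s' → s'.natMem v 0 = i →
      Inv i s' → Runs V L body s' (Inv (i + 1))) :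
    Runs V L (forLoop v b body) s (Inv N) := by
  -- The test costs 7 and the increment 6; a successful round adds 1, and the final failing test
  -- accounts for the 8.
  have key : ∀ r i s', i + r = N → Agree (v :: body.natW) body.realW s s' → s'.natMem v 0 = i →
      Inv i s' → ∃ t s'', Exec L (.loop (.natLe (.add (nv v) (.const 1)) (nv b))
        (.seq body (.storeNat v (.const 0) (.add (nv v) (.const 1))))) s' t s'' ∧
        t ≤ r * (7 + (body.time V + 6) + 1) + 8 ∧ Inv N s'' := by
    intro r
    induction r with
    | zero =>
      intro i s' hi ha hvi hInv
      have hbN : s'.natMem b 0 = N := by rw [ha.1 b hb, hN]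
      refine ⟨_, s', .loopDone ?_, ?_, ?_⟩
      · simp only [Test.Holds, NatExpr.eval, hvi, hbN]; omega
      · simp [Test.cost, NatExpr.cost]
      · obtain rfl : i = N := by omega
        exact hInv
    | succ r ih =>
      intro i s' hi ha hvi hInv
      have hbN : s'.natMem b 0 = N := by rw [ha.1 b hb, hN]
      obtain ⟨t₁, s₁, he, ht, hq⟩ := hstep i (by omega) s' ha hvi hInv
      have hv₁ : s₁.natMem v 0 = i := by rw [he.agree.1 v hv, hvi]
      have ha₁ : Agree (v :: body.natW) body.realW s (s₁.setNat v 0 (i + 1)) :=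
        ((ha.trans he.agree).trans (.setNat s₁ v 0 (i + 1))).mono (by simp) (by simp)
      obtain ⟨t₂, s₂, he₂, ht₂, hq₂⟩ := ih (i + 1) (s₁.setNat v 0 (i + 1)) (by omega) ha₁
        (by simp [State.setNat]) (hI _ _ _ hq)
      refine ⟨_, s₂, .loopStep (T₂ := t₂) ?_ (.seq he (.storeNat _ _ _ _)) ?_, ?_, hq₂⟩
      · simp only [Test.Holds, NatExpr.eval, hvi, hbN]; omega
      · simpa only [NatExpr.eval, hv₁] using he₂
      · simp only [Test.cost, NatExpr.cost, add_mul] at ht₂ ⊢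
        omega
  obtain ⟨t, s', he, ht, hq⟩ := key N 0 (s.setNat v 0 0) (by omega)
    ((Agree.setNat s v 0 0).mono (by simp) (by simp)) (by simp [State.setNat]) (hI _ _ _ h0)
  refine ⟨_, s', .seq (.storeNat _ _ _ _) he, ?_, hq⟩
  have := Nat.mul_le_mul_right (7 + (body.time V + 6) + 1) hNV
  simp only [Program.time, Test.cost, NatExpr.cost, ReLUTraining.forLoop]
  ring_nf at this ht ⊢
  omega

open Matrix

/-! ## Solving linear systems by successive projections -/

/-- `P` is the orthogonal projection onto the orthogonal complement of `S`. -/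
structure IsProjection {ι : Type*} [Fintype ι] (P : Matrix ι ι ℝ) (S : Set (ι → ℝ)) : Prop where
  symm : Pᵀ = P
  idem : ∀ v, P *ᵥ (P *ᵥ v) = P *ᵥ v
  annihilates : ∀ a ∈ S, P *ᵥ a = 0
  fixes : ∀ v, (∀ a ∈ S, a ⬝ᵥ v = 0) → P *ᵥ v = v

/-- The projection `P` followed by the projection onto the orthogonal complement of `P *ᵥ a`. -/
noncomputable def projStep {ι : Type*} [Fintype ι] (P : Matrix ι ι ℝ) (a : ι → ℝ) : Matrix ι ι ℝ :=
  fun l m => P l m - (P *ᵥ a) l * (P *ᵥ a) m / ((P *ᵥ a) ⬝ᵥ (P *ᵥ a))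

section

variable {ι : Type*} [Fintype ι] {P : Matrix ι ι ℝ} {S : Set (ι → ℝ)}

theorem isProjection_one [DecidableEq ι] : IsProjection (1 : Matrix ι ι ℝ) ∅ where
  symm := by simp
  idem := by simp
  annihilates := by simp
  fixes := by simp

theorem projStep_mulVec (P : Matrix ι ι ℝ) (a v : ι → ℝ) :
    projStep P a *ᵥ v =
      P *ᵥ v - ((P *ᵥ a) ⬝ᵥ v / ((P *ᵥ a) ⬝ᵥ (P *ᵥ a))) • (P *ᵥ a) := by
  ext l
  set q := P *ᵥ a with hq
  change ∑ m, (P l m - q l * q m / (q ⬝ᵥ q)) * v m =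
    ∑ m, P l m * v m - (∑ m, q m * v m) / (q ⬝ᵥ q) * q l
  rw [Finset.sum_div, Finset.sum_mul, ← Finset.sum_sub_distrib]
  exact Finset.sum_congr rfl fun m _ => by ring

theorem IsProjection.dotProduct_mulVec (h : IsProjection P S) (u v : ι → ℝ) :
    (P *ᵥ u) ⬝ᵥ v = u ⬝ᵥ (P *ᵥ v) := by
  rw [Matrix.dotProduct_mulVec, ← mulVec_transpose, h.symm]

/-- A Gram–Schmidt step: `P *ᵥ a` is the part of `a` orthogonal to `S`, and its direction is
projected away. If it is zero, the quotients in `projStep` are `0 / 0 = 0` and `P` is unchanged, so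
linearly dependent equations need no special treatment. -/
theorem IsProjection.step (h : IsProjection P S) (a : ι → ℝ) :
    IsProjection (projStep P a) (insert a S) := by
  have hqa : (P *ᵥ a) ⬝ᵥ a = (P *ᵥ a) ⬝ᵥ (P *ᵥ a) := by
    rw [h.dotProduct_mulVec, h.dotProduct_mulVec, h.idem]
  have hqq : ∀ v, (P *ᵥ a) ⬝ᵥ (P *ᵥ v) = (P *ᵥ a) ⬝ᵥ v := fun v => by
    rw [← h.dotProduct_mulVec, h.idem]
  have hstep_q : projStep P a *ᵥ (P *ᵥ a) = 0 := by
    rw [projStep_mulVec, h.idem]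
    by_cases h0 : P *ᵥ a = 0
    · simp [h0]
    · rw [div_self (by simpa using h0), one_smul, sub_self]
  refine ⟨?_, ?_, ?_, ?_⟩
  · ext l m
    have : P m l = P l m := by conv_lhs => rw [← h.symm, transpose_apply]
    simp only [transpose_apply, projStep, this]
    ring
  · intro v
    have : projStep P a *ᵥ (P *ᵥ v) = projStep P a *ᵥ v := by
      rw [projStep_mulVec, projStep_mulVec, h.idem, hqq]
    conv_lhs => rw [projStep_mulVec P a v, mulVec_sub, mulVec_smul, hstep_q, smul_zero, sub_zero,
      this]
  · intro b hb
    rcases hb with rfl | hb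
    · rw [projStep_mulVec, hqa]
      by_cases h0 : P *ᵥ b = 0
      · simp [h0]
      · rw [div_self (by simpa using h0), one_smul, sub_self]
    · rw [projStep_mulVec, h.annihilates b hb, h.dotProduct_mulVec, h.annihilates b hb]
      simp
  · intro v hv
    have hv' := h.fixes v fun b hb => hv b (Set.mem_insert_of_mem _ hb)
    rw [projStep_mulVec, h.dotProduct_mulVec, hv', hv a (Set.mem_insert _ _)]
    simp

end

/-- The last row of the projection gives a solution of the linear system, if there is one. -/
theorem IsProjection.solution {K : ℕ} {P : Matrix (Fin (K + 1)) (Fin (K + 1)) ℝ}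
    {S : Set (Fin (K + 1) → ℝ)} (h : IsProjection P S) (z₀ : Fin K → ℝ)
    (hz₀ : ∀ a ∈ S, ∑ l : Fin K, a l.castSucc * z₀ l + a (Fin.last K) = 0) :
    ∀ a ∈ S, ∑ l : Fin K, a l.castSucc *
      (P (Fin.last K) l.castSucc / P (Fin.last K) (Fin.last K)) + a (Fin.last K) = 0 := by
  -- By symmetry the last row of `P` is the image of the last unit vector, hence orthogonal to `S`;
  -- it remains to rescale its last coordinate to 1.
  set p : Fin (K + 1) → ℝ := P (Fin.last K) with hp
  have hpe : P *ᵥ Pi.single (Fin.last K) 1 = p := by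
    ext l
    rw [mulVec_single_one, hp]
    conv_rhs => rw [← h.symm]
    rfl
  have hdot : ∀ v, p ⬝ᵥ v = (P *ᵥ v) (Fin.last K) := fun v => rfl
  have hpp : p ⬝ᵥ p = p (Fin.last K) := by
    rw [hdot, ← hpe, h.idem]
  -- The vector `(z₀, 1)` is orthogonal to `S`, so `P` fixes it. If the last entry of `p` were 0,
  -- then `p = 0` by `hpp`, and the last coordinate of `(z₀, 1)` would vanish.
  have hne : p (Fin.last K) ≠ 0 := by
    intro h0
    rw [h0, dotProduct_self_eq_zero] at hpp
    have h1 := h.fixes (Fin.snoc z₀ 1) fun a ha => by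
      simpa [dotProduct, Fin.sum_univ_castSucc] using hz₀ a ha
    have h2 := congrFun h1 (Fin.last K)
    rw [← hdot, hpp] at h2
    simp at h2
  intro a ha
  have h1 : p ⬝ᵥ a = 0 := by rw [hdot, h.annihilates a ha]; rfl
  rw [dotProduct, Fin.sum_univ_castSucc] at h1
  calc _ = (∑ l : Fin K, p l.castSucc * a l.castSucc + p (Fin.last K) * a (Fin.last K)) /
        p (Fin.last K) := by
        rw [add_div, Finset.sum_div, mul_div_cancel_left₀ _ hne]
        congr 1
        exact Finset.sum_congr rfl fun l _ => by ring
    _ = 0 := by rw [h1, zero_div]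

/-! ## Concave functions on polyhedra -/

/-- The point `z` is the convex combination of `z + t • v` and `z - u • v` with weights `u / (t +
u)` and `t / (t + u)`; denominators are cleared. -/
theorem concaveOn_line {E : Type*} [AddCommGroup E] [Module ℝ E] {C : Set E} {f : E → ℝ}
    (hf : ConcaveOn ℝ C f) {z v : E} {t u : ℝ} (ht : 0 < t) (hu : 0 < u) (hzt : z + t • v ∈ C)
    (hzu : z + u • -v ∈ C) : u * f (z + t • v) + t * f (z + u • -v) ≤ (t + u) * f z := by
  have h1 : u / (t + u) + t / (t + u) = 1 := by field_simp; ring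
  have h2 : (u / (t + u)) * t = t / (t + u) * u := by ring
  have hcomb : (u / (t + u)) • (z + t • v) + (t / (t + u)) • (z + u • -v) = z := by
    rw [smul_add, smul_add, smul_smul, smul_smul, smul_neg, h2]
    calc _ = (u / (t + u) + t / (t + u)) • z := by rw [add_smul]; abel
      _ = z := by rw [h1, one_smul]
  have hp : 0 < t + u := by positivity
  have h := hf.2 hzt hzu (div_nonneg hu.le hp.le) (div_nonneg ht.le hp.le) h1
  rw [hcomb, smul_eq_mul, smul_eq_mul, div_mul_eq_mul_div, div_mul_eq_mul_div, ← add_div,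
    div_le_iff₀ hp] at h
  linarith

section

variable {E : Type*} [AddCommGroup E] [Module ℝ E] {R : Type*} [Fintype R]
  {α : R → Module.Dual ℝ E} {β : R → ℝ}

/-- Moving from a point of a polyhedron until a new constraint becomes tight. -/
theorem exists_new_tight {z v : E} (hz : ∀ r, β r ≤ α r z) (hv : ∀ r, α r z = β r → α r v = 0)
    {r₀ : R} (hr₀ : α r₀ v < 0) :
    ∃ t : ℝ, 0 < t ∧ (∀ r, β r ≤ α r (z + t • v)) ∧
      ∃ r, α r z ≠ β r ∧ α r (z + t • v) = β r := by
  classical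
  -- Ratio test: of the constraints that decrease along `v`, take the first one to be reached. It is
  -- not tight at `z`, since `v` is annihilated by the tight ones.
  obtain ⟨r, hr, hmin⟩ := Finset.exists_min_image (Finset.univ.filter fun r => α r v < 0)
    (fun r => (α r z - β r) / -(α r v)) ⟨r₀, by simpa using hr₀⟩
  simp only [Finset.mem_filter, Finset.mem_univ, true_and] at hr hmin
  have hne : α r z ≠ β r := fun h => hr.ne (hv r h)
  have hpos : 0 < α r z - β r := sub_pos.2 (lt_of_le_of_ne (hz r) hne.symm)
  have ht : 0 < (α r z - β r) / -(α r v) := div_pos hpos (by linarith)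
  refine ⟨_, ht, fun r' => ?_, r, hne, ?_⟩
  · simp only [map_add, map_smul, smul_eq_mul]
    by_cases h : α r' v < 0
    · have := hmin r' h
      rw [le_div_iff₀ (by linarith)] at this
      linarith
    · have := mul_nonneg ht.le (not_lt.1 h)
      linarith [hz r']
  · simp only [map_add, map_smul, smul_eq_mul]
    have := hr.ne
    field_simp
    ring

/-- A concave function that is bounded below on a polyhedron does not increase when one passes to
a suitable point in which the tight constraints span all constraints. -/
theorem exists_tight_span {f : E → ℝ} (hf : ConcaveOn ℝ {z | ∀ r, β r ≤ α r z} f)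
    (hf0 : ∀ z, (∀ r, β r ≤ α r z) → 0 ≤ f z) {z₀ : E} (hz₀ : ∀ r, β r ≤ α r z₀) :
    ∃ z, (∀ r, β r ≤ α r z) ∧ f z ≤ f z₀ ∧
      ∀ r, α r ∈ Submodule.span ℝ (α '' {r | α r z = β r}) := by
  classical
  -- Induction on the number of constraints that are not tight.
  induction hN : (Finset.univ.filter fun r => α r z₀ ≠ β r).card using Nat.strong_induction_on
    generalizing z₀ with
  | _ N ih =>
  by_cases hspan : ∀ r, α r ∈ Submodule.span ℝ (α '' {r | α r z₀ = β r})
  · exact ⟨z₀, hz₀, le_rfl, hspan⟩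
  push Not at hspan
  obtain ⟨r₁, hr₁⟩ := hspan
  -- Duality: a functional that vanishes on the common kernel of finitely many others lies in their
  -- span. Passing to `-v` if necessary gives the sign.
  obtain ⟨v, hv, hr₁v⟩ : ∃ v, (∀ r, α r z₀ = β r → α r v = 0) ∧ α r₁ v < 0 := by
    by_contra! hcon
    refine hr₁ ?_
    rw [Set.image_eq_range]
    refine mem_span_of_iInf_ker_le_ker fun v hv => ?_
    have hv : ∀ r, α r z₀ = β r → α r v = 0 := fun r hr => by
      simpa using (Submodule.mem_iInf _).1 hv ⟨r, hr⟩
    have h1 := hcon v hv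
    have h2 := hcon (-v) fun r hr => by simp [hv r hr]
    rw [map_neg] at h2
    exact LinearMap.mem_ker.2 (by linarith)
  -- Along `v` the tight constraints stay tight and a new one is gained, so the induction hypothesis
  -- applies to the new point.
  have descend : ∀ (v : E) (t : ℝ), (∀ r, α r z₀ = β r → α r v = 0) →
      (∀ r, β r ≤ α r (z₀ + t • v)) → (∃ r, α r z₀ ≠ β r ∧ α r (z₀ + t • v) = β r) →
      f (z₀ + t • v) ≤ f z₀ → ∃ z, (∀ r, β r ≤ α r z) ∧ f z ≤ f z₀ ∧
        ∀ r, α r ∈ Submodule.span ℝ (α '' {r | α r z = β r}) := by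
    rintro v t hv hC ⟨r, hr, hr'⟩ hle
    obtain ⟨z, hz, hfz, hs⟩ := ih _ (by
      rw [← hN]
      refine Finset.card_lt_card (Finset.ssubset_iff.2 ⟨r, by simpa using hr', ?_⟩)
      intro r' h
      rw [Finset.mem_insert] at h
      rcases h with rfl | h
      · simpa using hr
      · simp only [Finset.mem_filter, Finset.mem_univ, true_and] at h ⊢
        intro h0
        exact h (by simp [hv r' h0, h0])) hC rfl
    exact ⟨z, hz, hfz.trans hle, hs⟩
  obtain ⟨t, ht, htC, htr⟩ := exists_new_tight hz₀ hv hr₁v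
  -- If some constraint also blocks the direction `-v`, concavity makes one of the two end points no
  -- worse than `z₀`.
  by_cases hneg : ∃ r, 0 < α r v
  · obtain ⟨r₂, hr₂⟩ := hneg
    have hv' : ∀ r, α r z₀ = β r → α r (-v) = 0 := fun r hr => by simp [hv r hr]
    obtain ⟨u, hu, huC, hur⟩ := exists_new_tight hz₀ hv' (r₀ := r₂) (by simpa using hr₂)
    have hconc := concaveOn_line hf ht hu htC huC
    by_cases hc : f (z₀ + t • v) ≤ f z₀
    · exact descend v t hv htC htr hc
    · refine descend (-v) u hv' huC hur ?_
      push Not at hc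
      by_contra! hc'
      nlinarith [mul_lt_mul_of_pos_left hc hu, mul_lt_mul_of_pos_left hc' ht]
  -- Otherwise the whole ray in direction `-v` is feasible. If `f` increased along `v`, concavity
  -- would make it negative far out on this ray; `u` is chosen so that this happens.
  · push Not at hneg
    refine descend v t hv htC htr ?_
    by_contra! hc
    obtain ⟨u, hu, hu'⟩ : ∃ u : ℝ, 0 < u ∧ t * f z₀ < u * (f (z₀ + t • v) - f z₀) := by
      have hpos : 0 < f (z₀ + t • v) - f z₀ := sub_pos.2 hc
      refine ⟨(t * f z₀ + 1) / (f (z₀ + t • v) - f z₀), ?_, ?_⟩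
      · have := hf0 z₀ hz₀
        positivity
      · rw [div_mul_cancel₀ _ hpos.ne']
        linarith
    have huC : ∀ r, β r ≤ α r (z₀ + u • -v) := fun r => by
      have := mul_nonpos_of_nonneg_of_nonpos hu.le (hneg r)
      simp only [map_add, map_smul, map_neg, smul_eq_mul]
      linarith [hz₀ r]
    have hconc := concaveOn_line hf ht hu htC huC
    have := mul_nonneg ht.le (hf0 _ huC)
    linarith

end

/-- A spanning sequence of prescribed length in a nonempty family of vectors. -/
theorem exists_seq_span_eq {E R : Type*} [AddCommGroup E] [Module ℝ E] [Finite R] (α : R → E) {T : Set R}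
    (hT : T.Nonempty) {M : ℕ} (hM : Module.finrank ℝ (Submodule.span ℝ (α '' T)) ≤ M) :
    ∃ g : ℕ → R, (∀ t, g t ∈ T) ∧
      ∀ p : Submodule ℝ E, (∀ t < M, α (g t) ∈ p) → ∀ r ∈ T, α r ∈ p := by
  have := FiniteDimensional.span_of_finite ℝ (Set.toFinite (α '' T))
  obtain ⟨f, hf, hspan, -⟩ := Submodule.exists_fun_fin_finrank_span_eq ℝ (α '' T)
  choose g hg hgf using hf
  obtain ⟨r₀, hr₀⟩ := hT
  -- A spanning sequence of length equal to the rank, padded by the fixed element `r₀`.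
  refine ⟨fun t => if h : t < _ then g ⟨t, h⟩ else r₀, fun t => ?_, fun p hp r hr => ?_⟩
  · by_cases h : t < Module.finrank ℝ (Submodule.span ℝ (α '' T))
    · simpa [h] using hg _
    · simpa [h] using hr₀
  · have h1 : Submodule.span ℝ (α '' T) ≤ p := by
      rw [← hspan, Submodule.span_le]
      rintro _ ⟨i, rfl⟩
      have := hp i (i.2.trans_le hM)
      simpa [hgf] using this
    exact h1 (Submodule.subset_span ⟨r, hr, rfl⟩)

open Finset (range)

/-! ## Candidate solutions

Weights and data are functions on addresses. The weights of the neuron `j` are at the addresses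
`j * (d + 1) + l` with `l < d`, its bias is at `j * (d + 1) + d`. -/

/-- The input `⟨w j, x i⟩ + b j` of the neuron `j` at the data point `i`, as a function of the
weights. -/
def preact (X : ℕ → ℝ) (d j i : ℕ) : Module.Dual ℝ (ℕ → ℝ) where
  toFun z := ∑ l ∈ range d, z (j * (d + 1) + l) * X (i * d + l) + z (j * (d + 1) + d)
  map_add' z z' := by simp only [Pi.add_apply, add_mul, Finset.sum_add_distrib]; ring
  map_smul' c z := by
    simp only [Pi.smul_apply, smul_eq_mul, RingHom.id_apply, mul_add, Finset.mul_sum, mul_assoc]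

theorem preact_apply (X : ℕ → ℝ) (d j i : ℕ) (z : ℕ → ℝ) : preact X d j i z =
    ∑ l ∈ range d, z (j * (d + 1) + l) * X (i * d + l) + z (j * (d + 1) + d) := rfl

/-- The output of the network at the data point `i`. -/
noncomputable def output (X : ℕ → ℝ) (d k : ℕ) (a z : ℕ → ℝ) (i : ℕ) : ℝ :=
  ∑ j ∈ range k, a j * max 0 (preact X d j i z)

/-- The training error. -/
noncomputable def totalLoss (L : ℝ → ℝ → ℝ) (X Y : ℕ → ℝ) (n d k : ℕ) (a z : ℕ → ℝ) : ℝ :=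
  ∑ i ∈ range n, L (output X d k a z i) (Y i)

/-- The coefficients of the equation that is encoded by `(i, h)`. In the first phase, `ph = 0`, it
states that the neuron `h` or `h - k` has input `1` or `-1` at the data point `i`. In the second
phase, it states that the neuron `h` has input `0` at `i`, or that `i` is fitted perfectly if the
neurons are active where they are active for the weights `zo`. -/
noncomputable def eqCoef (X : ℕ → ℝ) (d k ph : ℕ) (zo a : ℕ → ℝ) (i h j : ℕ) : ℝ :=
  if h = j then 1
  else if ph = 0 then (if h = j + k then -1 else 0)
  else if k ≤ h ∧ 0 ≤ preact X d j i zo then a j else 0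

/-- The right-hand side of the equation that is encoded by `(i, h)`. -/
noncomputable def eqRhs (Y : ℕ → ℝ) (k ph i h : ℕ) : ℝ :=
  if ph = 0 then 1 else if k ≤ h then Y i else 0

/-- The weights `z` satisfy the equation that is encoded by `(i, h)`. -/
def EqHolds (X Y : ℕ → ℝ) (d k ph : ℕ) (zo a : ℕ → ℝ) (i h : ℕ) (z : ℕ → ℝ) : Prop :=
  ∑ j ∈ range k, eqCoef X d k ph zo a i h j * preact X d j i z = eqRhs Y k ph i h

/-- The weights `z` satisfy the `M` equations that are encoded by the digits `D` from the position
`st` on. -/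
def Solves (X Y : ℕ → ℝ) (n d k M ph st : ℕ) (D : ℕ → ℕ) (zo a z : ℕ → ℝ) : Prop :=
  ∀ t < M, EqHolds X Y d k ph zo a (min (D (st + (t + t))) (n - 1)) (D (st + (t + t) + 1)) z

/-- The coefficients `a` and the weights `z` are a result of processing the digits `D`. -/
def IsCandidate (X Y : ℕ → ℝ) (n d k M : ℕ) (D : ℕ → ℕ) (a z : ℕ → ℝ) : Prop :=
  (∀ j < k, a j = if D (M + M + (M + M) + j) = 0 then -1 else 1) ∧
  ∃ zo z₁, ((∃ z', Solves X Y n d k M 0 0 D zo a z') → Solves X Y n d k M 0 0 D zo a z₁) ∧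
    ((∃ z', Solves X Y n d k M 1 (M + M) D z₁ a z') → Solves X Y n d k M 1 (M + M) D z₁ a z)

/-! ### Completeness: every network is matched by a candidate -/

theorem preact_mem_span_proj (X : ℕ → ℝ) (d k : ℕ) {j : ℕ} (hj : j < k) (i : ℕ) :
    preact X d j i ∈ Submodule.span ℝ (Set.range fun c : Fin (k * (d + 1)) =>
      (LinearMap.proj (c : ℕ) : Module.Dual ℝ (ℕ → ℝ))) := by
  have hlt : ∀ l, l ≤ d → j * (d + 1) + l < k * (d + 1) := fun l hl =>
    calc j * (d + 1) + l < (j + 1) * (d + 1) := by rw [add_mul]; omega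
      _ ≤ k * (d + 1) := Nat.mul_le_mul_right _ hj
  have hproj : ∀ l, l ≤ d → (LinearMap.proj (j * (d + 1) + l) : Module.Dual ℝ (ℕ → ℝ)) ∈
      Submodule.span ℝ (Set.range fun c : Fin (k * (d + 1)) =>
      (LinearMap.proj (c : ℕ) : Module.Dual ℝ (ℕ → ℝ))) := fun l hl =>
    Submodule.subset_span ⟨⟨_, hlt l hl⟩, rfl⟩
  have : preact X d j i = ∑ l ∈ range d, X (i * d + l) • (LinearMap.proj (j * (d + 1) + l) :
      Module.Dual ℝ (ℕ → ℝ)) + LinearMap.proj (j * (d + 1) + d) := by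
    ext z
    simp [preact, LinearMap.sum_apply, mul_comm]
  rw [this]
  refine add_mem (Submodule.sum_mem _ fun l hl => Submodule.smul_mem _ _ (hproj l ?_)) (hproj d le_rfl)
  exact (Finset.mem_range.1 hl).le

/-- There are `k * n` neuron inputs, and they involve only `k * (d + 1)` weights and biases. The
bound by `n` is what keeps the number of candidates bounded when `n * k = 1`. -/
theorem finrank_span_le {X : ℕ → ℝ} {n d k : ℕ} {S : Set (Module.Dual ℝ (ℕ → ℝ))}
    (hS : S ⊆ Submodule.span ℝ (Set.range fun r : Fin k × Fin n => preact X d r.1 r.2)) :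
    Module.finrank ℝ (Submodule.span ℝ S) ≤ k * min n (d + 1) := by
  have hS' := Submodule.span_le.2 hS
  rw [← Nat.mul_min_mul_left]
  refine le_min ?_ ?_
  · have := FiniteDimensional.span_of_finite ℝ
      (Set.finite_range fun r : Fin k × Fin n => preact X d r.1 r.2)
    refine (Submodule.finrank_mono hS').trans ((finrank_range_le_card _).trans ?_)
    simp
  · have := FiniteDimensional.span_of_finite ℝ
      (Set.finite_range fun c : Fin (k * (d + 1)) =>
        (LinearMap.proj (c : ℕ) : Module.Dual ℝ (ℕ → ℝ)))
    refine (Submodule.finrank_mono (hS'.trans ?_)).trans ((finrank_range_le_card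
      fun c : Fin (k * (d + 1)) => (LinearMap.proj (c : ℕ) : Module.Dual ℝ (ℕ → ℝ))).trans ?_)
    · rw [Submodule.span_le]
      rintro _ ⟨r, rfl⟩
      exact preact_mem_span_proj X d k r.1.2 r.2
    · simp

/-- The weights `0` with bias `1`. -/
theorem preact_bias (X : ℕ → ℝ) (d j i : ℕ) :
    preact X d j i (fun c => if c % (d + 1) = d then 1 else 0) = 1 := by
  have h : ∀ l, l ≤ d → (j * (d + 1) + l) % (d + 1) = l := fun l hl => by
    rw [mul_comm, Nat.mul_add_mod, Nat.mod_eq_of_lt (by omega)]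
  simp only [preact, LinearMap.coe_mk, AddHom.coe_mk, h d le_rfl, if_true]
  rw [Finset.sum_eq_zero, zero_add]
  intro l hl
  have hl := Finset.mem_range.1 hl
  rw [h l hl.le, if_neg hl.ne, zero_mul]

theorem sum_ite_single {k j₀ : ℕ} (h : j₀ < k) (c : ℕ → ℝ) (p : ℕ → ℝ)
    (hc : ∀ j < k, j ≠ j₀ → c j = 0) : ∑ j ∈ range k, c j * p j = c j₀ * p j₀ := by
  rw [Finset.sum_eq_single j₀]
  · intro j hj hne
    rw [hc j (Finset.mem_range.1 hj) hne, zero_mul]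
  · intro hn
    exact absurd (Finset.mem_range.2 h) hn

/-- The activation pattern of any weights is found in the first phase. -/
theorem exists_pattern_equations (X Y : ℕ → ℝ) {n d k : ℕ} (hn : 1 ≤ n) (hk : 1 ≤ k) (z₀ : ℕ → ℝ) :
    ∃ g : ℕ → ℕ × ℕ, (∀ t, (g t).1 < n ∧ (g t).2 < 2 * k) ∧
      (∃ z, ∀ zo a, ∀ t < k * min n (d + 1), EqHolds X Y d k 0 zo a (g t).1 (g t).2 z) ∧
      ∀ zo a z, (∀ t < k * min n (d + 1), EqHolds X Y d k 0 zo a (g t).1 (g t).2 z) →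
        ∀ j < k, ∀ i < n, (0 ≤ preact X d j i z ↔ 0 ≤ preact X d j i z₀) := by
  classical
  let sg : Fin k × Fin n → ℝ := fun r => if 0 ≤ preact X d r.1 r.2 z₀ then 1 else -1
  let α : Fin k × Fin n → Module.Dual ℝ (ℕ → ℝ) := fun r => sg r • preact X d r.1 r.2
  -- After scaling by `c` and raising all biases by 1, a negative input `p` becomes `c * p + 1`,
  -- which is at most `-1` as soon as `c * |p| ≥ 2`. A nonnegative input becomes at least 1, also
  -- when it was 0, where the quotient is 0 by convention.
  obtain ⟨c, hc0, hc⟩ : ∃ c : ℝ, 0 ≤ c ∧ ∀ r : Fin k × Fin n,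
      2 / |preact X d r.1 r.2 z₀| ≤ c := by
    refine ⟨∑ r : Fin k × Fin n, 2 / |preact X d r.1 r.2 z₀|, by positivity, fun r => ?_⟩
    exact Finset.single_le_sum (f := fun r : Fin k × Fin n => 2 / |preact X d r.1 r.2 z₀|)
      (fun _ _ => by positivity) (Finset.mem_univ r)
  have hstart : ∀ r, (1 : ℝ) ≤ α r (c • z₀ + fun c => if c % (d + 1) = d then 1 else 0) := by
    intro r
    simp only [α, LinearMap.smul_apply, map_add, map_smul, preact_bias, smul_eq_mul, sg]
    split_ifs with h
    · nlinarith
    · push Not at h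
      have := hc r
      rw [abs_of_neg h, div_le_iff₀ (by linarith)] at this
      linarith
  -- There is nothing to minimize here: with objective 0 only the spanning property is used.
  obtain ⟨z₁, hz₁, -, hspan⟩ := exists_tight_span (α := α) (β := fun _ => 1) (f := fun _ => 0)
    (concaveOn_const 0 (by
      intro u hu v hv a b ha hb hab r
      have h1 := mul_le_mul_of_nonneg_left (hu r) ha
      have h2 := mul_le_mul_of_nonneg_left (hv r) hb
      simp only [map_add, map_smul, smul_eq_mul]
      linarith)) (fun _ _ => le_rfl) hstart
  have hT : {r | α r z₁ = 1}.Nonempty := by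
    by_contra hT
    rw [Set.not_nonempty_iff_eq_empty] at hT
    have h := hspan (⟨0, hk⟩, ⟨0, hn⟩)
    rw [hT, Set.image_empty, Submodule.span_empty, Submodule.mem_bot] at h
    have := hz₁ (⟨0, hk⟩, ⟨0, hn⟩)
    rw [h] at this
    simp at this
    linarith
  obtain ⟨g, hg, hgs⟩ := exists_seq_span_eq α hT (M := k * min n (d + 1)) (finrank_span_le (by
    rintro _ ⟨r, -, rfl⟩
    exact Submodule.smul_mem _ _ (Submodule.subset_span ⟨r, rfl⟩)))
  -- The shift by `k` marks the sign `-1`, that is, an inactive neuron.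
  let code : ℕ → ℕ × ℕ := fun t =>
    ((g t).2, if 0 ≤ preact X d (g t).1 (g t).2 z₀ then ((g t).1 : ℕ) else (g t).1 + k)
  have hcode : ∀ t zo a z, EqHolds X Y d k 0 zo a (code t).1 (code t).2 z ↔ α (g t) z = 1 := by
    intro t zo a z
    have hj := (g t).1.2
    simp only [EqHolds, code, α, sg, eqRhs, if_true, LinearMap.smul_apply, smul_eq_mul]
    split_ifs with h
    · rw [sum_ite_single hj, eqCoef, if_pos rfl]
      intro j hjk hne
      rw [eqCoef, if_neg hne.symm, if_pos rfl, if_neg (by omega)]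
    · rw [sum_ite_single hj, eqCoef, if_neg (by omega), if_pos rfl, if_pos rfl]
      intro j hjk hne
      rw [eqCoef, if_neg (by omega), if_pos rfl, if_neg (by omega)]
  refine ⟨code, fun t => ⟨(g t).2.2, ?_⟩, ⟨z₁, fun zo a t _ => (hcode t zo a z₁).2 (hg t)⟩, ?_⟩
  · have := (g t).1.2
    simp only [code]
    split_ifs <;> omega
  · intro zo a z hz j hj i hi
    -- `z` and `z₁` agree on the chosen functionals, hence on all tight ones, hence on all of the `α
    -- r`, which lie in their span.
    have hker : ∀ r, α r (z - z₁) = 0 := fun r =>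
      (Submodule.span_le (p := LinearMap.ker (Module.Dual.eval ℝ (ℕ → ℝ) (z - z₁)))).2 (by
        rintro _ ⟨r', hr', rfl⟩
        refine hgs (LinearMap.ker (Module.Dual.eval ℝ (ℕ → ℝ) (z - z₁))) (fun t ht => ?_) r' hr'
        have h1 := (hcode t zo a z).1 (hz t ht)
        have h2 : α (g t) z₁ = 1 := hg t
        simp [h1, h2]) (hspan r)
    have h1 := hker (⟨j, hj⟩, ⟨i, hi⟩)
    have h2 := hz₁ (⟨j, hj⟩, ⟨i, hi⟩)
    rw [map_sub, sub_eq_zero] at h1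
    rw [← h1] at h2
    simp only [α, sg, LinearMap.smul_apply, smul_eq_mul] at h2
    split_ifs at h2 with h
    · exact ⟨fun _ => h, fun _ => by linarith⟩
    · exact ⟨fun h' => by linarith, fun h' => absurd h' h⟩

/-- If the activation pattern of `z₀` is known, then weights that are at least as good as `z₀` are
found in the second phase. -/
theorem exists_fit_equations {L : ℝ → ℝ → ℝ} {ell : ℝ → ℝ} (hell : ConcaveOn ℝ (Set.Ici 0) ell)
    (hpos : ∀ t, 0 ≤ t → 0 ≤ ell t) (hL : ∀ yhat y, L yhat y = ell |yhat - y|)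
    (X Y : ℕ → ℝ) {n d k : ℕ} (hn : 1 ≤ n) (hk : 1 ≤ k) (a z₀ : ℕ → ℝ) :
    ∃ g : ℕ → ℕ × ℕ, (∀ t, (g t).1 < n ∧ (g t).2 < 2 * k) ∧
      ∀ zo, (∀ j < k, ∀ i < n, (0 ≤ preact X d j i zo ↔ 0 ≤ preact X d j i z₀)) →
      (∃ z, ∀ t < k * min n (d + 1), EqHolds X Y d k 1 zo a (g t).1 (g t).2 z) ∧
      ∀ z, (∀ t < k * min n (d + 1), EqHolds X Y d k 1 zo a (g t).1 (g t).2 z) →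
        totalLoss L X Y n d k a z ≤ totalLoss L X Y n d k a z₀ := by
  classical
  -- The output at the point `i` with the activation pattern frozen at that of `z₀`: unlike
  -- `output`, it is linear in the weights.
  let res : ℕ → Module.Dual ℝ (ℕ → ℝ) := fun i =>
    ∑ j ∈ range k, (if 0 ≤ preact X d j i z₀ then a j else 0) • preact X d j i
  let sg : Fin k × Fin n → ℝ := fun r => if 0 ≤ preact X d r.1 r.2 z₀ then 1 else -1
  let ts : ℕ → ℝ := fun i => if Y i ≤ res i z₀ then 1 else -1
  -- The polyhedron preserves the activation pattern and the residual signs of `z₀`. A tight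
  -- constraint of the first kind says that an input is 0, one of the second kind that a point is
  -- fitted.
  let α : (Fin k × Fin n) ⊕ Fin n → Module.Dual ℝ (ℕ → ℝ) :=
    Sum.elim (fun r => sg r • preact X d r.1 r.2) (fun i => ts i • res i)
  let β : (Fin k × Fin n) ⊕ Fin n → ℝ := Sum.elim (fun _ => 0) (fun i => ts i * Y i)
  have hsg : ∀ r, sg r ≠ 0 := fun r => by
    simp only [sg]; split_ifs <;> norm_num
  have hts : ∀ i, ts i ≠ 0 := fun r => by
    simp only [ts]; split_ifs <;> norm_num
  have hstart : ∀ r, β r ≤ α r z₀ := by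
    rintro (r | i)
    · simp only [α, β, sg, Sum.elim_inl, LinearMap.smul_apply, smul_eq_mul]
      split_ifs with h <;> linarith
    · simp only [α, β, ts, Sum.elim_inr, LinearMap.smul_apply, smul_eq_mul]
      split_ifs with h <;> linarith
  let f : (ℕ → ℝ) → ℝ := fun z => ∑ i : Fin n, ell (ts i * (res i z - Y i))
  have hnn : ∀ z, (∀ r, β r ≤ α r z) → ∀ i : Fin n, 0 ≤ ts i * (res i z - Y i) := by
    intro z hz i
    have := hz (Sum.inr i)
    simp only [α, β, Sum.elim_inr, LinearMap.smul_apply, smul_eq_mul] at this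
    linarith
  -- Weak inequalities suffice: at input 0 an active and an inactive neuron give the same output.
  have hout : ∀ z, (∀ r, β r ≤ α r z) → ∀ i : Fin n, output X d k a z i = res i z := by
    intro z hz i
    simp only [output, res, LinearMap.sum_apply, LinearMap.smul_apply, smul_eq_mul]
    refine Finset.sum_congr rfl fun j hj => ?_
    have := hz (Sum.inl (⟨j, Finset.mem_range.1 hj⟩, i))
    simp only [α, β, sg, Sum.elim_inl, LinearMap.smul_apply, smul_eq_mul] at this
    split_ifs at this ⊢ with h
    · rw [max_eq_right (by linarith)]
    · rw [max_eq_left (by linarith), mul_zero, zero_mul]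
  have htotal : ∀ z, (∀ r, β r ≤ α r z) → totalLoss L X Y n d k a z = f z := by
    intro z hz
    rw [totalLoss, Finset.sum_range]
    refine Finset.sum_congr rfl fun i _ => ?_
    rw [hL, hout z hz i]
    have h1 := hnn z hz i
    congr 1
    simp only [ts] at h1 ⊢
    split_ifs at h1 ⊢ with h
    · rw [abs_of_nonneg (by linarith), one_mul]
    · rw [abs_of_nonpos (by linarith)]; ring
  have hconv : Convex ℝ {z | ∀ r, β r ≤ α r z} := by
    intro u hu v hv a b ha hb hab r
    have h1 := mul_le_mul_of_nonneg_left (hu r) ha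
    have h2 := mul_le_mul_of_nonneg_left (hv r) hb
    have h3 : (a + b) * β r = β r := by rw [hab, one_mul]
    simp only [map_add, map_smul, smul_eq_mul]
    linarith
  have hconc : ConcaveOn ℝ {z | ∀ r, β r ≤ α r z} f := by
    refine ⟨hconv, fun u hu v hv a b ha hb hab => ?_⟩
    simp only [f, smul_eq_mul, Finset.mul_sum, ← Finset.sum_add_distrib]
    refine Finset.sum_le_sum fun i _ => ?_
    have h1 := hell.2 (hnn u hu i) (hnn v hv i) ha hb hab
    simp only [smul_eq_mul] at h1
    refine h1.trans (le_of_eq (congrArg ell ?_))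
    simp only [map_add, map_smul, smul_eq_mul]
    linear_combination (-(ts i * Y i)) * hab
  obtain ⟨z₁, hz₁, hfz₁, hspan⟩ := exists_tight_span hconc
    (fun z hz => Finset.sum_nonneg fun i _ => hpos _ (hnn z hz i)) hstart
  -- With no tight constraint every `α r` would be 0, but a neuron input is not the zero functional,
  -- as the weights with bias 1 show.
  have hT : {r | α r z₁ = β r}.Nonempty := by
    by_contra hT
    rw [Set.not_nonempty_iff_eq_empty] at hT
    have h := hspan (Sum.inl (⟨0, hk⟩, ⟨0, hn⟩))
    rw [hT, Set.image_empty, Submodule.span_empty, Submodule.mem_bot] at h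
    have h' := (smul_eq_zero.1 h).resolve_left (hsg _)
    have := preact_bias X d 0 0
    simp only at h'
    rw [h'] at this
    simp at this
  obtain ⟨g, hg, hgs⟩ := exists_seq_span_eq α hT (M := k * min n (d + 1)) (finrank_span_le (by
    rintro _ ⟨r, -, rfl⟩
    rcases r with r | i
    · exact Submodule.smul_mem _ _ (Submodule.subset_span ⟨r, rfl⟩)
    · refine Submodule.smul_mem _ _ (Submodule.sum_mem _ fun j hj => Submodule.smul_mem _ _
        (Submodule.subset_span ⟨(⟨j, Finset.mem_range.1 hj⟩, i), rfl⟩))))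
  let code : (Fin k × Fin n) ⊕ Fin n → ℕ × ℕ :=
    Sum.elim (fun r => ((r.2 : ℕ), (r.1 : ℕ))) (fun i => ((i : ℕ), k))
  refine ⟨fun t => code (g t), fun t => ?_, fun zo hzo => ?_⟩
  · change (code (g t)).1 < n ∧ (code (g t)).2 < 2 * k
    rcases g t with r | i
    · exact ⟨r.2.2, by have := r.1.2; simp only [code, Sum.elim_inl]; omega⟩
    · exact ⟨i.2, by simp only [code, Sum.elim_inr]; omega⟩
  -- The signs `sg` and `ts` are nonzero and cancel from the equations, so the codes need not record
  -- them. The fitting equation uses the pattern of `zo`, which is that of `z₀` by `hzo`.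
  have hcode : ∀ r z, EqHolds X Y d k 1 zo a (code r).1 (code r).2 z ↔ α r z = β r := by
    rintro (r | i) z
    · have hj := r.1.2
      change (∑ j ∈ range k, eqCoef X d k 1 zo a r.2 r.1 j * preact X d j r.2 z =
        eqRhs Y k 1 r.2 r.1) ↔ sg r * preact X d r.1 r.2 z = 0
      rw [eqRhs, if_neg one_ne_zero, if_neg (by omega), sum_ite_single hj, eqCoef, if_pos rfl,
        one_mul, mul_eq_zero, or_iff_right (hsg r)]
      intro j hjk hne
      rw [eqCoef, if_neg hne.symm, if_neg one_ne_zero, if_neg (by omega)]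
    · change (∑ j ∈ range k, eqCoef X d k 1 zo a i k j * preact X d j i z = eqRhs Y k 1 i k) ↔
        ts i * res i z = ts i * Y i
      rw [eqRhs, if_neg one_ne_zero, if_pos le_rfl, mul_right_inj' (hts i)]
      simp only [res, LinearMap.sum_apply, LinearMap.smul_apply, smul_eq_mul]
      rw [Finset.sum_congr rfl fun j hj => ?_]
      have hj := Finset.mem_range.1 hj
      rw [eqCoef, if_neg (by omega), if_neg one_ne_zero]
      simp only [le_refl, true_and, hzo j hj i i.2]
  refine ⟨⟨z₁, fun t _ => (hcode _ _).2 (hg t)⟩, fun z hz => ?_⟩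
  have hker : ∀ r, α r (z - z₁) = 0 := fun r =>
    (Submodule.span_le (p := LinearMap.ker (Module.Dual.eval ℝ (ℕ → ℝ) (z - z₁)))).2 (by
      rintro _ ⟨r', hr', rfl⟩
      refine hgs (LinearMap.ker (Module.Dual.eval ℝ (ℕ → ℝ) (z - z₁))) (fun t ht => ?_) r' hr'
      have h1 := (hcode _ z).1 (hz t ht)
      have h2 : α (g t) z₁ = β (g t) := hg t
      simp [h1, h2]) (hspan r)
  -- The system may have many solutions, but all of them share the constraint values of `z₁`, hence
  -- lie in the polyhedron and have the same error as `z₁`.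
  have heq : ∀ r, α r z = α r z₁ := fun r => by
    have := hker r
    rwa [map_sub, sub_eq_zero] at this
  have hzC : ∀ r, β r ≤ α r z := fun r => by rw [heq]; exact hz₁ r
  rw [htotal z hzC, htotal z₀ hstart]
  refine le_trans (le_of_eq ?_) hfz₁
  refine Finset.sum_congr rfl fun i _ => ?_
  have := heq (Sum.inr i)
  simp only [α, Sum.elim_inr, LinearMap.smul_apply, smul_eq_mul, mul_right_inj' (hts i)] at this
  rw [this]

theorem totalLoss_congr (L : ℝ → ℝ → ℝ) (X Y : ℕ → ℝ) (n d : ℕ) {k : ℕ} {a a' : ℕ → ℝ}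
    (h : ∀ j < k, a j = a' j) (z : ℕ → ℝ) :
    totalLoss L X Y n d k a z = totalLoss L X Y n d k a' z :=
  Finset.sum_congr rfl fun i _ => by
    rw [output, output, Finset.sum_congr rfl fun j hj => by rw [h j (Finset.mem_range.1 hj)]]

/-- Any coefficients and weights are matched by the candidates for suitable digits. -/
theorem exists_digits {L : ℝ → ℝ → ℝ} {ell : ℝ → ℝ} (hell : ConcaveOn ℝ (Set.Ici 0) ell)
    (hpos : ∀ t, 0 ≤ t → 0 ≤ ell t) (hL : ∀ yhat y, L yhat y = ell |yhat - y|)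
    (X Y : ℕ → ℝ) {n d k M : ℕ} (hM : M = k * min n (d + 1)) (hn : 1 ≤ n) (hk : 1 ≤ k)
    (a₀ z₀ : ℕ → ℝ) (ha₀ : ∀ j < k, a₀ j = -1 ∨ a₀ j = 1) :
    ∃ D : ℕ → ℕ, (∀ t, D t < k * n + k * n) ∧
      ∀ a z, IsCandidate X Y n d k M D a z →
        totalLoss L X Y n d k a z ≤ totalLoss L X Y n d k a₀ z₀ := by
  classical
  subst hM
  set M := k * min n (d + 1) with hM
  obtain ⟨g₁, hg₁, hex₁, hall₁⟩ := exists_pattern_equations X Y (d := d) hn hk z₀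
  obtain ⟨g₂, hg₂, h₂⟩ := exists_fit_equations hell hpos hL X Y (d := d) hn hk a₀ z₀
  -- The base `k * n + k * n` exceeds every digit in use: point indices below `n`, equation codes
  -- below `2 * k`, and sign digits 0 and 1.
  have hkn : k ≤ k * n := Nat.le_mul_of_pos_right k hn
  have hnk : n ≤ k * n := Nat.le_mul_of_pos_left n hk
  -- Layout: `2 * M` digits for the pairs of the first phase, `2 * M` for those of the second
  -- (points at even, codes at odd positions), then the signs.
  let pr : ℕ × ℕ → ℕ → ℕ := fun g t => if t % 2 = 0 then g.1 else g.2
  let D : ℕ → ℕ := fun t =>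
    if t < M + M then pr (g₁ (t / 2)) t
    else if t < M + M + (M + M) then pr (g₂ ((t - (M + M)) / 2)) (t - (M + M))
    else if a₀ (t - (M + M + (M + M))) = -1 then 0 else 1
  have hD1 : ∀ t < M, min (D (0 + (t + t))) (n - 1) = (g₁ t).1 ∧ D (0 + (t + t) + 1) = (g₁ t).2 := by
    intro t ht
    have h1 := (hg₁ t).1
    simp only [D, pr]
    rw [if_pos (by omega), if_pos (by omega), if_pos (by omega), if_neg (by omega),
      show (0 + (t + t)) / 2 = t by omega, show (0 + (t + t) + 1) / 2 = t by omega]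
    exact ⟨by omega, rfl⟩
  have hD2 : ∀ t < M, min (D (M + M + (t + t))) (n - 1) = (g₂ t).1 ∧
      D (M + M + (t + t) + 1) = (g₂ t).2 := by
    intro t ht
    have h1 := (hg₂ t).1
    simp only [D, pr]
    rw [if_neg (by omega), if_pos (by omega), if_pos (by omega), if_neg (by omega),
      if_pos (by omega), if_neg (by omega), show (M + M + (t + t) - (M + M)) / 2 = t by omega,
      show (M + M + (t + t) + 1 - (M + M)) / 2 = t by omega]
    exact ⟨by omega, rfl⟩
  refine ⟨D, fun t => ?_, ?_⟩
  · have h1 := hg₁ (t / 2)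
    have h2 := hg₂ ((t - (M + M)) / 2)
    simp only [D, pr]
    split_ifs <;> omega
  · rintro a z ⟨ha, zo, z₁, hz₁, hz⟩
    have haa : ∀ j < k, a j = a₀ j := by
      intro j hj
      have hDj : D (M + M + (M + M) + j) = if a₀ j = -1 then 0 else 1 := by
        simp only [D]
        rw [if_neg (by omega), if_neg (by omega), Nat.add_sub_cancel_left]
      rw [ha j hj, hDj]
      rcases ha₀ j hj with h | h
      · simp [h]
      · have : ¬ ((1 : ℝ) = -1) := by norm_num
        simp [h, this]
    have hcoef : ∀ ph zo i h z, EqHolds X Y d k ph zo a i h z ↔ EqHolds X Y d k ph zo a₀ i h z := by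
      intro ph zo i h z
      rw [EqHolds, EqHolds, Finset.sum_congr rfl fun j hj => ?_]
      rw [eqCoef, eqCoef, haa j (Finset.mem_range.1 hj)]
    have hS1 : ∀ z, Solves X Y n d k M 0 0 D zo a z ↔
        ∀ t < M, EqHolds X Y d k 0 zo a (g₁ t).1 (g₁ t).2 z := fun z =>
      forall₂_congr fun t ht => by rw [(hD1 t ht).1, (hD1 t ht).2]
    have hS2 : ∀ z, Solves X Y n d k M 1 (M + M) D z₁ a z ↔
        ∀ t < M, EqHolds X Y d k 1 z₁ a₀ (g₂ t).1 (g₂ t).2 z := fun z =>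
      forall₂_congr fun t ht => by rw [(hD2 t ht).1, (hD2 t ht).2, hcoef]
    -- The first system is soluble, so `z₁` solves it and has the pattern of `z₀`; this makes the
    -- second system soluble and any solution of it good enough.
    obtain ⟨z', hz'⟩ := hex₁
    have hpat := hall₁ zo a z₁ ((hS1 z₁).1 (hz₁ ⟨z', (hS1 z').2 (hz' zo a)⟩))
    obtain ⟨⟨z'', hz''⟩, hle⟩ := h₂ z₁ hpat
    rw [totalLoss_congr L X Y n d haa]
    exact hle z ((hS2 z).1 (hz ⟨z'', (hS2 z'').2 hz''⟩))

/-- Digit sequences are the base-`B` representations of the numbers below `B ^ len`. -/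
theorem exists_number_of_digits {B : ℕ} (len : ℕ) (D : ℕ → ℕ) (hD : ∀ t, D t < B) :
    ∃ c < B ^ len, ∀ t < len, c / B ^ t % B = D t := by
  refine ⟨finFunctionFinEquiv (fun t : Fin len => ⟨D t, hD t⟩), Fin.is_lt _, fun t ht => ?_⟩
  have := congrFun (finFunctionFinEquiv.symm_apply_apply
    (fun t : Fin len => (⟨D t, hD t⟩ : Fin B))) ⟨t, ht⟩
  exact congrArg Fin.val this

/-! ## Program fragments -/

section

variable {V : ℕ} {L : ℝ → ℝ → ℝ} {s : State}

@[simp] theorem natMem_setNat_self (s : State) (m i v : ℕ) :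
    (s.setNat m i v).natMem m = Function.update (s.natMem m) i v := by simp [State.setNat]

theorem natMem_setNat_of_ne (s : State) {m m' : ℕ} (h : m' ≠ m) (i v : ℕ) :
    (s.setNat m i v).natMem m' = s.natMem m' := by simp [State.setNat, h]

@[simp] theorem realMem_setNat (s : State) (m i v : ℕ) :
    (s.setNat m i v).realMem = s.realMem := rfl

@[simp] theorem realMem_setReal_self (s : State) (m i : ℕ) (v : ℝ) :
    (s.setReal m i v).realMem m = Function.update (s.realMem m) i v := by simp [State.setReal]

theorem realMem_setReal_of_ne (s : State) {m m' : ℕ} (h : m' ≠ m) (i : ℕ) (v : ℝ) :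
    (s.setReal m i v).realMem m' = s.realMem m' := by simp [State.setReal, h]

/-- Fill a segment of a bank of real numbers. -/
theorem Runs.fill {v b m N base : ℕ} {c : Program} (g : ℕ → ℝ) (hv : v ∉ c.natW)
    (hb : b ∉ v :: c.natW) (hN : s.natMem b 0 = N) (hNV : N ≤ V)
    (hstep : ∀ i < N, ∀ s', Agree (v :: c.natW) c.realW s s' → s'.natMem v 0 = i →
      s'.realMem m (base + i) = s.realMem m (base + i) →
      Runs V L c s' fun s'' => s''.realMem m = Function.update (s'.realMem m) (base + i) (g i)) :
    Runs V L (ReLUTraining.forLoop v b c) s fun s' => (∀ i < N, s'.realMem m (base + i) = g i) ∧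
      ∀ a, a < base ∨ base + N ≤ a → s'.realMem m a = s.realMem m a := by
  refine Runs.forLoop (fun i s' => (∀ j < i, s'.realMem m (base + j) = g j) ∧
      ∀ a, a < base ∨ base + i ≤ a → s'.realMem m a = s.realMem m a) hv hb hN hNV
      (fun _ _ _ h => h) ⟨by simp, by simp⟩ ?_
  rintro i hi s' ha hvi ⟨h1, h2⟩
  refine (hstep i hi s' ha hvi (h2 _ (by omega))).imp fun s'' _ h => ⟨fun j hj => ?_, fun a ha => ?_⟩
  · rw [h]
    rcases Nat.lt_succ_iff_lt_or_eq.1 hj with hj | rfl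
    · rw [Function.update_of_ne (by omega), h1 j hj]
    · rw [Function.update_self]
  · rw [h, Function.update_of_ne (by omega), h2 a (by omega)]

/-- Fill a square matrix that is stored row by row. -/
theorem Runs.fillMatrix {v v' b m N : ℕ} {c : Program} (g : ℕ → ℕ → ℝ)
    (hv : v ∉ v' :: c.natW) (hv' : v' ∉ c.natW) (hb : b ∉ v :: v' :: c.natW)
    (hN : s.natMem b 0 = N) (hNV : N ≤ V)
    (hstep : ∀ i < N, ∀ j < N, ∀ s', Agree (v :: v' :: c.natW) c.realW s s' →
      s'.natMem v 0 = i → s'.natMem v' 0 = j →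
      s'.realMem m (i * N + j) = s.realMem m (i * N + j) →
      Runs V L c s' fun s'' => s''.realMem m = Function.update (s'.realMem m) (i * N + j) (g i j)) :
    Runs V L (ReLUTraining.forLoop v b (ReLUTraining.forLoop v' b c)) s fun s' =>
      ∀ i < N, ∀ j < N, s'.realMem m (i * N + j) = g i j := by
  have hW : (ReLUTraining.forLoop v' b c).natW ⊆ v' :: c.natW := by
    simp [ReLUTraining.forLoop, Program.natW]
  have hR : (ReLUTraining.forLoop v' b c).realW ⊆ c.realW := by
    simp [ReLUTraining.forLoop, Program.realW]
  refine (Runs.forLoop (fun i s' => (∀ r < i, ∀ j < N, s'.realMem m (r * N + j) = g r j) ∧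
      ∀ a, i * N ≤ a → s'.realMem m a = s.realMem m a) (fun h => hv (hW h)) (fun h => hb ?_) hN hNV
      (fun _ _ _ h => h) ⟨by simp, by simp⟩ ?_).imp fun s' _ h => h.1
  · rcases List.mem_cons.1 h with h | h
    · simp [h]
    · exact List.mem_cons_of_mem _ (hW h)
  rintro i hi s' ha hvi ⟨h1, h2⟩
  have ha' : Agree (v :: v' :: c.natW) c.realW s s' :=
    ha.mono (List.cons_subset_cons _ hW) hR
  refine (Runs.fill (m := m) (base := i * N) (g i) hv' (fun h => hb (List.mem_cons_of_mem _ h))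
    (by rw [ha'.1 b hb, hN]) hNV ?_).imp ?_
  · intro j hj s'' ha₂ hvj hold
    refine hstep i hi j hj s'' ((ha'.trans ha₂).mono (by simp) (by simp)) ?_ hvj ?_
    · rw [ha₂.1 v hv, hvi]
    · rw [hold, h2 _ (by omega)]
  · rintro s'' - ⟨h3, h4⟩
    refine ⟨fun r hr j hj => ?_, fun a ha => ?_⟩
    · rcases Nat.lt_succ_iff_lt_or_eq.1 hr with hr | rfl
      · rw [h4 _ (Or.inl ?_), h1 r hr j hj]
        calc r * N + j < (r + 1) * N := by rw [add_mul]; omega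
          _ ≤ i * N := Nat.mul_le_mul_right _ hr
      · exact h3 j hj
    · rw [add_mul, one_mul] at ha
      rw [h4 a (Or.inr ha), h2 a (by omega)]

/-- Sum up the values of an expression. -/
def sumLoop (v b m : ℕ) (e : RealExpr) : Program :=
  .seq (.storeReal m (.const 0) (.const 0))
    (forLoop v b (.storeReal m (.const 0) (.add (rv m) e)))

theorem Runs.sumLoop {v b m N : ℕ} {e : RealExpr} (g : ℕ → ℝ) (hb : b ≠ v)
    (hN : s.natMem b 0 = N) (hNV : N ≤ V)
    (he : ∀ i < N, ∀ s', Agree [v] [m] s s' → s'.natMem v 0 = i → e.eval L s' = g i) :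
    Runs V L (sumLoop v b m e) s fun s' => s'.realMem m 0 = ∑ i ∈ range N, g i := by
  refine Runs.seq (Q₁ := fun s' => s'.realMem m 0 = 0)
    (.storeReal (by simp [NatExpr.eval, RealExpr.eval])) fun s₁ ha₁ h₁ => ?_
  refine Runs.forLoop (fun i s' => s'.realMem m 0 = ∑ j ∈ range i, g j) (by simp [Program.natW])
    (by simpa [Program.natW] using hb) (N := N) (by rw [ha₁.1 b (by simp [Program.natW]), hN]) hNV
    (fun _ _ _ h => h) (by simpa using h₁) ?_
  intro i hi s' ha hvi h
  refine .storeReal ?_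
  rw [realMem_setReal_self]
  simp only [NatExpr.eval, RealExpr.eval, Function.update_self, h, Finset.sum_range_succ]
  rw [he i hi s' ((ha₁.trans ha).mono (by simp [Program.natW]) (by simp [Program.realW])) hvi]

/-- Store the multiples `0, S, …, N * S` of the content `S` of a variable. -/
def mulTable (v b m S : ℕ) : Program :=
  .seq (.storeNat m (.const 0) (.const 0))
    (forLoop v b (.storeNat m (.add (nv v) (.const 1)) (.add (.read m (nv v)) (nv S))))

/-- Natural numbers cannot be multiplied on this machine, so the products needed for addresses are
tabulated by repeated addition and looked up. -/
theorem Runs.mulTable {v b m S N c : ℕ} (hvm : v ≠ m) (hb : b ≠ v ∧ b ≠ m) (hS : S ≠ v ∧ S ≠ m)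
    (hN : s.natMem b 0 = N) (hNV : N ≤ V) (hc : s.natMem S 0 = c) :
    Runs V L (mulTable v b m S) s fun s' => ∀ j ≤ N, s'.natMem m j = j * c := by
  refine Runs.seq (Q₁ := fun s' => s'.natMem m 0 = 0)
    (.storeNat (by simp [NatExpr.eval])) fun s₁ ha₁ h₁ => ?_
  refine Runs.forLoop (fun i s' => ∀ j ≤ i, s'.natMem m j = j * c)
    (by simpa [Program.natW] using hvm) (by simpa [Program.natW] using hb) (N := N)
    (by rw [ha₁.1 b (by simpa [Program.natW] using hb.2), hN]) hNV
    (fun i s' x h j hj => by rw [natMem_setNat_of_ne _ hvm.symm, h j hj]) ?_ ?_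
  · intro j hj
    obtain rfl : j = 0 := by omega
    simpa using h₁
  intro i hi s' ha hvi h
  refine .storeNat fun j hj => ?_
  have hS' : s'.natMem S 0 = c := by
    rw [ha.1 S (by simpa [Program.natW] using hS), ha₁.1 S (by simpa [Program.natW] using hS.2), hc]
  rw [natMem_setNat_self]
  simp only [NatExpr.eval, hvi, hS', h i le_rfl]
  rcases Nat.lt_succ_iff_lt_or_eq.1 (Nat.lt_succ_iff.2 hj) with hj | rfl
  · rw [Function.update_of_ne (by omega), h j (by omega)]
  · rw [Function.update_self]; ring

/-- Test for equality. -/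
def eqTest (e f : NatExpr) : Test := .and (.natLe e f) (.natLe f e)

theorem eqTest_holds {e f : NatExpr} : (eqTest e f).Holds L s ↔ e.eval s = f.eval s :=
  le_antisymm_iff.symm

end

/-! ## The invariable part of the memory -/

/-- The number of equations of each of the two linear systems. -/
def eqCount (n d k : ℕ) : ℕ := k * min n (d + 1)

/-- The base of the number system. -/
def digitBase (n k : ℕ) : ℕ := k * n + k * n

/-- The number of digits that encode a candidate. -/
def digitCount (n d k : ℕ) : ℕ :=
  eqCount n d k + eqCount n d k + (eqCount n d k + eqCount n d k) + k

/-- The number of candidates. -/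
def candCount (n d k : ℕ) : ℕ := digitBase n k ^ digitCount n d k

/-- All loops that depend on `n`, `d`, `k` are repeated at most `V` times. -/
structure SizeBound (V n d k : ℕ) : Prop where
  hn : 1 ≤ n
  hk : 1 ≤ k
  points : n ≤ V
  dim : d ≤ V
  neurons : k ≤ V
  eqs : eqCount n d k ≤ V
  width : k * (d + 1) + 1 ≤ V
  base : digitBase n k ≤ V
  digits : digitCount n d k ≤ V
  cands : candCount n d k ≤ V

/-- The data and the numbers and tables that are computed once. -/
structure Env (n d k : ℕ) (X Y : ℕ → ℝ) (γ : ℝ) (s : State) : Prop where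
  points : s.natMem 0 0 = n
  dim : s.natMem 1 0 = d
  neurons : s.natMem 2 0 = k
  eqs : s.natMem 6 0 = eqCount n d k
  params : s.natMem 7 0 = k * (d + 1)
  width : s.natMem 8 0 = k * (d + 1) + 1
  base : s.natMem 10 0 = digitBase n k
  digits : s.natMem 11 0 = digitCount n d k
  cands : s.natMem 12 0 = candCount n d k
  mulD : ∀ j ≤ digitBase n k, s.natMem 14 j = j * d
  mulE : ∀ j ≤ k, s.natMem 15 j = j * (d + 1)
  mulW : ∀ j ≤ k * (d + 1) + 1, s.natMem 17 j = j * (k * (d + 1) + 1)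
  x : s.realMem 0 = X
  y : s.realMem 1 = Y
  target : s.realMem 2 0 = γ

section

variable {V n d k : ℕ} {X Y : ℕ → ℝ} {γ : ℝ} {L : ℝ → ℝ → ℝ} {s s' : State}

theorem SizeBound.n_le_base (h : SizeBound V n d k) : n ≤ digitBase n k :=
  (Nat.le_mul_of_pos_left n h.hk).trans (Nat.le_add_right _ _)

theorem SizeBound.k_le_base (h : SizeBound V n d k) : k ≤ digitBase n k :=
  (Nat.le_mul_of_pos_right k h.hn).trans (Nat.le_add_right _ _)

/-- After the setup, natural banks below 18 and real banks below 3 are reserved for the environment;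
the working banks of the candidate computation lie above. -/
theorem Env.of_agree {nw rw : List ℕ} (h : Env n d k X Y γ s) (ha : Agree nw rw s s')
    (hn : ∀ m < 18, m ∉ nw) (hr : ∀ m < 3, m ∉ rw) : Env n d k X Y γ s' := by
  have e := fun m hm => ha.1 m (hn m hm)
  have e' := fun m hm => ha.2 m (hr m hm)
  constructor
  · rw [e 0 (by norm_num), h.points]
  · rw [e 1 (by norm_num), h.dim]
  · rw [e 2 (by norm_num), h.neurons]
  · rw [e 6 (by norm_num), h.eqs]
  · rw [e 7 (by norm_num), h.params]
  · rw [e 8 (by norm_num), h.width]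
  · rw [e 10 (by norm_num), h.base]
  · rw [e 11 (by norm_num), h.digits]
  · rw [e 12 (by norm_num), h.cands]
  · rw [e 14 (by norm_num)]; exact h.mulD
  · rw [e 15 (by norm_num)]; exact h.mulE
  · rw [e 17 (by norm_num)]; exact h.mulW
  · rw [e' 0 (by norm_num), h.x]
  · rw [e' 1 (by norm_num), h.y]
  · rw [e' 2 (by norm_num), h.target]

/-! ## The parts of the algorithm -/

/-- Compute the input of the neuron `jv` at the data point `iv` for the weights in the bank `zb`. -/
def preactProg (zb jv iv : ℕ) : Program :=
  .seq (sumLoop 42 1 13 (.mul (.read zb (.add (.read 15 (nv jv)) (nv 42)))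
      (.read 0 (.add (.read 14 (nv iv)) (nv 42)))))
    (.storeReal 13 (.const 0) (.add (rv 13) (.read zb (.add (.read 15 (nv jv)) (nv 1)))))

theorem preactProg_runs (hV : SizeBound V n d k) (hs : Env n d k X Y γ s) {zb jv iv i j : ℕ}
    (hz : zb ≠ 13) (hjv : jv ≠ 42) (hiv : iv ≠ 42) (hj : s.natMem jv 0 = j) (hi : s.natMem iv 0 = i)
    (hjk : j < k) (hin : i < n) :
    Runs V L (preactProg zb jv iv) s fun s' =>
      s'.realMem 13 0 = preact X d j i (s.realMem zb) := by
  refine Runs.seq (Runs.sumLoop (fun l => s.realMem zb (j * (d + 1) + l) * X (i * d + l))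
    (by decide) hs.dim hV.dim ?_) fun s₁ ha₁ h₁ => ?_
  · intro l _ s' ha hl
    have hs' := hs.of_agree ha (by decide) (by decide)
    have hb := hV.n_le_base
    simp only [RealExpr.eval, NatExpr.eval, hl, ha.1 jv (by simpa using hjv),
      ha.1 iv (by simpa using hiv), hj, hi, hs'.mulE j hjk.le, hs'.mulD i (by omega),
      ha.2 zb (by simpa using hz), hs'.x]
  · have ha : Agree [42] [13] s s₁ := ha₁.mono (by simp [sumLoop, Program.natW, forLoop])
      (by simp [sumLoop, Program.realW, forLoop])
    have hs' := hs.of_agree ha (by decide) (by decide)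
    refine .storeReal ?_
    rw [realMem_setReal_self]
    have hjv' : s₁.natMem jv = s.natMem jv := ha.1 jv (by simpa using hjv)
    have hz' : s₁.realMem zb = s.realMem zb := ha.2 zb (by simpa using hz)
    simp only [RealExpr.eval, NatExpr.eval, Function.update_self, h₁, hjv', hz', hj,
      hs'.mulE j hjk.le, hs'.dim]
    rfl

/-- Compute the equation that is encoded by the contents of the variables `37` and `38`. -/
def eqProg : Program :=
  .seq
    (forLoop 39 2 (.seq (preactProg 20 39 37)
      (.cond (eqTest (nv 38) (nv 39)) (.storeReal 21 (nv 39) (.const 1))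
        (.cond (.natLe (nv 46) (.const 0))
          (.cond (eqTest (nv 38) (.add (nv 39) (nv 2)))
            (.storeReal 21 (nv 39) (.sub (.const 0) (.const 1)))
            (.storeReal 21 (nv 39) (.const 0)))
          (.cond (.and (.natLe (nv 2) (nv 38)) (.realLe (.const 0) (rv 13)))
            (.storeReal 21 (nv 39) (.read 17 (nv 39)))
            (.storeReal 21 (nv 39) (.const 0)))))))
    (.cond (.natLe (nv 46) (.const 0)) (.storeReal 22 (.const 0) (.const 1))
      (.cond (.natLe (nv 2) (nv 38)) (.storeReal 22 (.const 0) (.read 1 (nv 37)))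
        (.storeReal 22 (.const 0) (.const 0))))

theorem eqProg_runs (hV : SizeBound V n d k) (hs : Env n d k X Y γ s) {i h ph : ℕ}
    (hi : s.natMem 37 0 = i) (hin : i < n) (hh : s.natMem 38 0 = h) (hph : s.natMem 46 0 = ph) :
    Runs V L eqProg s fun s' =>
      (∀ j < k, s'.realMem 21 j = eqCoef X d k ph (s.realMem 20) (s.realMem 17) i h j) ∧
        s'.realMem 22 0 = eqRhs Y k ph i h := by
  refine Runs.seq (Q₁ := fun s' => ∀ j < k, s'.realMem 21 j =
      eqCoef X d k ph (s.realMem 20) (s.realMem 17) i h j)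
    ((Runs.fill (m := 21) (base := 0) (fun j => eqCoef X d k ph (s.realMem 20) (s.realMem 17) i h j)
      (by decide) (by decide) hs.neurons hV.neurons ?_).imp fun s' _ h j hj => by simpa using h.1 j hj)
    fun s₁ ha₁ h₁ => ?_
  · intro j hj s' ha hvj _
    have hs' := hs.of_agree ha (by decide) (by decide)
    refine Runs.seq (preactProg_runs hV hs' (by decide) (by decide) (by decide) hvj
      (by rw [ha.1 37 (by decide), hi]) hj hin) fun s₂ ha₂ h₂ => ?_
    have hs₂ := hs'.of_agree ha₂ (by decide) (by decide)
    rw [ha.2 20 (by decide)] at h₂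
    have e38 : s₂.natMem 38 0 = h := by rw [ha₂.1 38 (by decide), ha.1 38 (by decide), hh]
    have e39 : s₂.natMem 39 0 = j := by rw [ha₂.1 39 (by decide), hvj]
    have e46 : s₂.natMem 46 0 = ph := by rw [ha₂.1 46 (by decide), ha.1 46 (by decide), hph]
    have e17 : s₂.realMem 17 = s.realMem 17 := by rw [ha₂.2 17 (by decide), ha.2 17 (by decide)]
    have e21 : s₂.realMem 21 = s'.realMem 21 := ha₂.2 21 (by decide)
    have hcell : ∀ e : RealExpr, e.eval L s₂ = eqCoef X d k ph (s.realMem 20) (s.realMem 17) i h j →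
        Runs V L (.storeReal 21 (nv 39) e) s₂ fun s'' => s''.realMem 21 =
          Function.update (s'.realMem 21) (0 + j)
            (eqCoef X d k ph (s.realMem 20) (s.realMem 17) i h j) := fun e he =>
      .storeReal (by rw [realMem_setReal_self, he, e21]; simp [NatExpr.eval, e39])
    refine .cond (fun t₁ => hcell _ ?_) fun t₁ => .cond (fun t₂ => ?_) fun t₂ => ?_
    · simp only [eqTest_holds, NatExpr.eval, e38, e39] at t₁
      simp [RealExpr.eval, eqCoef, t₁]
    · simp only [eqTest_holds, NatExpr.eval, e38, e39] at t₁
      simp only [Test.Holds, NatExpr.eval, e46, Nat.le_zero] at t₂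
      refine .cond (fun t₃ => hcell _ ?_) fun t₃ => hcell _ ?_
      · simp only [eqTest_holds, NatExpr.eval, e38, e39, hs₂.neurons] at t₃
        rw [eqCoef, if_neg t₁, if_pos t₂, if_pos t₃]
        simp [RealExpr.eval]
      · simp only [eqTest_holds, NatExpr.eval, e38, e39, hs₂.neurons] at t₃
        rw [eqCoef, if_neg t₁, if_pos t₂, if_neg t₃]
        simp [RealExpr.eval]
    · simp only [eqTest_holds, NatExpr.eval, e38, e39] at t₁
      simp only [Test.Holds, NatExpr.eval, e46, Nat.le_zero] at t₂
      refine .cond (fun t₃ => hcell _ ?_) fun t₃ => hcell _ ?_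
      · simp only [Test.Holds, NatExpr.eval, RealExpr.eval, e38, hs₂.neurons, h₂, Nat.cast_zero] at t₃
        rw [eqCoef, if_neg t₁, if_neg t₂, if_pos t₃]
        simp [RealExpr.eval, NatExpr.eval, e17, e39]
      · simp only [Test.Holds, NatExpr.eval, RealExpr.eval, e38, hs₂.neurons, h₂, Nat.cast_zero] at t₃
        rw [eqCoef, if_neg t₁, if_neg t₂, if_neg t₃]
        simp [RealExpr.eval]
  · have hs₁ := hs.of_agree ha₁ (by decide) (by decide)
    have e37 : s₁.natMem 37 0 = i := by rw [ha₁.1 37 (by decide), hi]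
    have e38 : s₁.natMem 38 0 = h := by rw [ha₁.1 38 (by decide), hh]
    have e46 : s₁.natMem 46 0 = ph := by rw [ha₁.1 46 (by decide), hph]
    have hcell : ∀ e : RealExpr, e.eval L s₁ = eqRhs Y k ph i h →
        Runs V L (.storeReal 22 (.const 0) e) s₁ fun s' =>
          (∀ j < k, s'.realMem 21 j = eqCoef X d k ph (s.realMem 20) (s.realMem 17) i h j) ∧
            s'.realMem 22 0 = eqRhs Y k ph i h := fun e he =>
      .storeReal ⟨by rw [realMem_setReal_of_ne _ (by decide)]; exact h₁,
        by rw [realMem_setReal_self, he]; simp [NatExpr.eval]⟩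
    refine .cond (fun t₂ => hcell _ ?_) fun t₂ => .cond (fun t₃ => hcell _ ?_) fun t₃ => hcell _ ?_
    all_goals
      simp only [Test.Holds, NatExpr.eval, e46, e38, hs₁.neurons, Nat.le_zero] at *
      simp [RealExpr.eval, NatExpr.eval, eqRhs, *, hs₁.y]

end

/-! ### Writing down and solving the linear systems -/

section

variable {V n d k : ℕ} {X Y : ℕ → ℝ} {γ : ℝ} {L : ℝ → ℝ → ℝ} {s s' : State}

/-- Write the coefficients of the current equation, with respect to all weights and to the constant
term, to the bank `23`. -/
def rowProg : Program :=
  .seq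
    (forLoop 39 2 (.seq
      (forLoop 42 1 (.storeReal 23 (.add (.read 15 (nv 39)) (nv 42))
        (.mul (.read 21 (nv 39)) (.read 0 (.add (.read 14 (nv 37)) (nv 42))))))
      (.storeReal 23 (.add (.read 15 (nv 39)) (nv 1)) (.read 21 (nv 39)))))
    (.storeReal 23 (nv 7) (.sub (.const 0) (rv 22)))

/-- The vector `r` consists of the coefficients of the equation
`∑ j, cf j * preact X d j i z - rhs = 0` in the unknowns `z`. -/
def IsRow (X : ℕ → ℝ) (d k i : ℕ) (cf : ℕ → ℝ) (rhs : ℝ) (r : Fin (k * (d + 1) + 1) → ℝ) : Prop :=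
  ∀ z : ℕ → ℝ, ∑ l : Fin (k * (d + 1)), r l.castSucc * z l + r (Fin.last _) =
    ∑ j ∈ range k, cf j * preact X d j i z - rhs

theorem sum_range_mul (k e : ℕ) (f : ℕ → ℝ) :
    ∑ c ∈ range (k * e), f c = ∑ j ∈ range k, ∑ l ∈ range e, f (j * e + l) := by
  induction k with
  | zero => simp
  | succ k ih => rw [add_mul, one_mul, Finset.sum_range_add, ih, Finset.sum_range_succ]

theorem rowProg_runs (hV : SizeBound V n d k) (hs : Env n d k X Y γ s) {i : ℕ}
    (hi : s.natMem 37 0 = i) (hin : i < n) {cf : ℕ → ℝ} (hcf : ∀ j < k, s.realMem 21 j = cf j) :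
    Runs V L rowProg s fun s' => IsRow X d k i cf (s.realMem 22 0) fun l => s'.realMem 23 l := by
  have hb := hV.n_le_base
  refine Runs.seq (Runs.forLoop (fun j s' => ∀ j' < j, (∀ l < d, s'.realMem 23 (j' * (d + 1) + l) =
      cf j' * X (i * d + l)) ∧ s'.realMem 23 (j' * (d + 1) + d) = cf j') (by decide) (by decide)
      hs.neurons hV.neurons (fun _ _ _ h => h) (by simp) ?_) fun s₁ ha₁ h₁ => ?_
  · intro j hj s₁ ha₁ hvj h
    have hs₁ := hs.of_agree ha₁ (by decide) (by decide)
    have hlt : ∀ j' < j, j' * (d + 1) + d < j * (d + 1) := fun j' hj' =>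
      calc j' * (d + 1) + d < (j' + 1) * (d + 1) := by rw [add_mul]; omega
        _ ≤ j * (d + 1) := Nat.mul_le_mul_right _ hj'
    refine Runs.seq (Runs.fill (m := 23) (base := j * (d + 1)) (fun l => cf j * X (i * d + l))
      (by decide) (by decide) hs₁.dim hV.dim ?_) fun s₂ ha₂ h₂ => ?_
    · intro l _ s₂ ha₂ hl _
      have hs₂ := hs₁.of_agree ha₂ (by decide) (by decide)
      refine .storeReal ?_
      rw [realMem_setReal_self]
      simp only [RealExpr.eval, NatExpr.eval, hl, ha₂.1 39 (by decide), ha₂.1 37 (by decide),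
        ha₁.1 37 (by decide), hi, hvj, hs₂.mulE j hj.le, hs₂.mulD i (by omega), hs₂.x,
        ha₂.2 21 (by decide), ha₁.2 21 (by decide), hcf j hj]
    · have hs₂ := hs₁.of_agree ha₂ (by decide) (by decide)
      refine .storeReal ?_
      rw [realMem_setReal_self]
      simp only [RealExpr.eval, NatExpr.eval, ha₂.1 39 (by decide), hvj, hs₂.mulE j hj.le, hs₂.dim,
        ha₂.2 21 (by decide), ha₁.2 21 (by decide), hcf j hj]
      intro j' hj'
      rcases Nat.lt_succ_iff_lt_or_eq.1 hj' with hj' | rfl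
      · have := hlt j' hj'
        refine ⟨fun l hl => ?_, ?_⟩
        · rw [Function.update_of_ne (by omega), h₂.2 _ (Or.inl (by omega)), (h j' hj').1 l hl]
        · rw [Function.update_of_ne (by omega), h₂.2 _ (Or.inl (by omega)), (h j' hj').2]
      · refine ⟨fun l hl => ?_, Function.update_self _ _ _⟩
        rw [Function.update_of_ne (by omega), h₂.1 l hl]
  · have hs₁ := hs.of_agree ha₁ (by decide) (by decide)
    have hlt : ∀ j < k, j * (d + 1) + d < k * (d + 1) := fun j hj =>
      calc j * (d + 1) + d < (j + 1) * (d + 1) := by rw [add_mul]; omega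
        _ ≤ k * (d + 1) := Nat.mul_le_mul_right _ hj
    refine .storeReal fun z => ?_
    rw [realMem_setReal_self]
    simp only [RealExpr.eval, NatExpr.eval, hs₁.params, ha₁.2 22 (by decide), Fin.val_castSucc,
      Fin.val_last, Function.update_self, Nat.cast_zero, zero_sub, ← sub_eq_add_neg]
    congr 1
    -- The unknowns are split into blocks of length `d + 1`, one for each neuron, with the bias at
    -- the end of the block.
    rw [← Finset.sum_range (fun l => Function.update (s₁.realMem 23) (k * (d + 1))
      (-s.realMem 22 0) l * z l), sum_range_mul]
    refine Finset.sum_congr rfl fun j hj => ?_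
    have hj := Finset.mem_range.1 hj
    have := hlt j hj
    rw [Finset.sum_range_succ, Function.update_of_ne (by omega), (h₁ j hj).2]
    rw [preact_apply, mul_add (cf j), Finset.mul_sum]
    congr 1
    refine Finset.sum_congr rfl fun l hl => ?_
    have hl := Finset.mem_range.1 hl
    rw [Function.update_of_ne (by omega), (h₁ j hj).1 l hl]
    ring

/-- The matrix `P` is stored in the bank `11`. -/
def HoldsMatrix {W : ℕ} (s : State) (P : Matrix (Fin W) (Fin W) ℝ) : Prop :=
  ∀ l m : Fin W, s.realMem 11 (l * W + m) = P l m

/-- Replace the matrix `P` in the bank `11` by `projStep P r` for the vector `r` in the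
bank `23`. -/
def projProg : Program :=
  .seq
    (forLoop 42 8 (.seq
      (sumLoop 43 8 13 (.mul (.read 11 (.add (.read 17 (nv 42)) (nv 43))) (.read 23 (nv 43))))
      (.storeReal 12 (nv 42) (rv 13))))
    (.seq (sumLoop 42 8 14 (.mul (.read 12 (nv 42)) (.read 12 (nv 42))))
      (forLoop 42 8 (forLoop 43 8 (.storeReal 11 (.add (.read 17 (nv 42)) (nv 43))
        (.sub (.read 11 (.add (.read 17 (nv 42)) (nv 43)))
          (.div (.mul (.read 12 (nv 42)) (.read 12 (nv 43))) (rv 14)))))))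

theorem projProg_runs (hV : SizeBound V n d k) (hs : Env n d k X Y γ s) {W : ℕ}
    (hW : W = k * (d + 1) + 1) {P : Matrix (Fin W) (Fin W) ℝ} (hP : HoldsMatrix s P) :
    Runs V L projProg s fun s' => HoldsMatrix s' (projStep P fun l => s.realMem 23 l) := by
  have hWV : W ≤ V := hW ▸ hV.width
  set q : ℕ → ℝ := fun l => ∑ m ∈ range W, s.realMem 11 (l * W + m) * s.realMem 23 m with hq
  refine Runs.seq (Runs.fill (m := 12) (base := 0) q (by decide) (by decide) (hs.width.trans hW.symm) hWV ?_)
    fun s₁ ha₁ h₁ => ?_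
  · intro l hl s₁ ha₁ hvl _
    have hs₁ := hs.of_agree ha₁ (by decide) (by decide)
    refine Runs.seq (Runs.sumLoop (fun m => s.realMem 11 (l * W + m) * s.realMem 23 m) (by decide)
      (hs₁.width.trans hW.symm) hWV ?_) fun s₂ ha₂ h₂ => ?_
    · intro m _ s₂ ha₂ hvm
      have hs₂ := hs₁.of_agree ha₂ (by decide) (by decide)
      simp only [RealExpr.eval, NatExpr.eval, hvm, ha₂.1 42 (by decide), hvl, hs₂.mulW l (hW ▸ hl.le),
        ha₂.2 11 (by decide), ha₁.2 11 (by decide), ha₂.2 23 (by decide), ha₁.2 23 (by decide),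
        ← hW]
    · refine .storeReal ?_
      rw [realMem_setReal_self]
      simp only [RealExpr.eval, NatExpr.eval, h₂, ha₂.1 42 (by decide), hvl, zero_add,
        ha₂.2 12 (by decide), hq]
  replace h₁ : ∀ l < W, s₁.realMem 12 l = q l := fun l hl => by simpa using h₁.1 l hl
  have hs₁ := hs.of_agree ha₁ (by decide) (by decide)
  refine Runs.seq (Runs.sumLoop (fun l => q l * q l) (by decide) (hs₁.width.trans hW.symm) hWV ?_)
    fun s₂ ha₂ h₂ => ?_
  · intro l hl s₂ ha₂ hvl
    simp only [RealExpr.eval, NatExpr.eval, hvl, ha₂.2 12 (by decide), h₁ l hl]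
  have hs₂ := hs₁.of_agree ha₂ (by decide) (by decide)
  refine (Runs.fillMatrix (m := 11) (fun l m => s.realMem 11 (l * W + m) -
    q l * q m / ∑ l ∈ range W, q l * q l) (by decide) (by decide) (by decide) (hs₂.width.trans hW.symm) hWV
    ?_).imp ?_
  -- The matrix is overwritten in place. This is safe because `P *ᵥ r` and its squared norm have
  -- been saved, and each entry is read only in the step that replaces it, when it still has its old
  -- content (`hold`).
  · intro l hl m hm s₃ ha₃ hvl hvm hold
    have hs₃ := hs₂.of_agree ha₃ (by decide) (by decide)
    refine .storeReal ?_
    rw [realMem_setReal_self]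
    rw [ha₂.2 11 (by decide), ha₁.2 11 (by decide)] at hold
    simp only [RealExpr.eval, NatExpr.eval, hvl, hvm, hs₃.mulW l (hW ▸ hl.le), ← hW, hold,
      ha₃.2 12 (by decide), ha₃.2 14 (by decide), ha₂.2 12 (by decide), h₁ l hl, h₁ m hm, h₂]
  · intro s₃ _ h₃ l m
    have hqP : ∀ l : Fin W, q l = (P *ᵥ fun l => s.realMem 23 l) l := by
      intro l
      rw [hq]
      simp only [Finset.sum_range, hP l, mulVec, dotProduct]
    rw [h₃ l l.2 m m.2, projStep, hP l m, hqP, hqP, Finset.sum_range]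
    simp only [hqP]
    rfl

/-- Solve the linear system that is encoded by the digits from the position in the variable `45`
on. -/
def solveProg : Program :=
  .seq
    (forLoop 42 8 (forLoop 43 8 (.cond (eqTest (nv 42) (nv 43))
      (.storeReal 11 (.add (.read 17 (nv 42)) (nv 43)) (.const 1))
      (.storeReal 11 (.add (.read 17 (nv 42)) (nv 43)) (.const 0)))))
    (forLoop 36 6 (.seq
      (.storeNat 37 (.const 0) (.sub (.read 31 (.add (nv 45) (.add (nv 36) (nv 36))))
        (.sub (.read 31 (.add (nv 45) (.add (nv 36) (nv 36)))) (.sub (nv 0) (.const 1)))))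
      (.seq
        (.storeNat 38 (.const 0) (.read 31 (.add (.add (nv 45) (.add (nv 36) (nv 36))) (.const 1))))
        (.seq eqProg (.seq rowProg projProg)))))

/-- Loop invariant: the bank holds the projection for a set `S` of homogenized rows whose common
solutions are exactly those of the equations processed so far. Each round inserts one row into `S`.
-/
theorem solveProg_runs (hV : SizeBound V n d k) (hs : Env n d k X Y γ s) {ph st : ℕ} {D : ℕ → ℕ}
    {zo a : ℕ → ℝ} (hph : s.natMem 46 0 = ph) (hst : s.natMem 45 0 = st) (hD : s.natMem 31 = D)
    (hzo : s.realMem 20 = zo) (ha : s.realMem 17 = a) :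
    Runs V L solveProg s fun s' =>
      ∃ (P : Matrix (Fin (k * (d + 1) + 1)) (Fin (k * (d + 1) + 1)) ℝ)
        (S : Set (Fin (k * (d + 1) + 1) → ℝ)), HoldsMatrix s' P ∧ IsProjection P S ∧
        ∀ z : ℕ → ℝ, (∀ r ∈ S, ∑ l : Fin (k * (d + 1)), r l.castSucc * z l + r (Fin.last _) = 0) ↔
          Solves X Y n d k (eqCount n d k) ph st D zo a z := by
  refine Runs.seq (Runs.fillMatrix (m := 11) (fun l m => if l = m then 1 else 0) (by decide)
    (by decide) (by decide) hs.width hV.width ?_) fun s₁ ha₁ h₁ => ?_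
  · intro l hl m hm s₁ ha₁ hvl hvm _
    have hs₁ := hs.of_agree ha₁ (by decide) (by decide)
    refine .cond (fun t => .storeReal ?_) fun t => .storeReal ?_
    all_goals
      simp only [eqTest_holds, NatExpr.eval, hvl, hvm] at t
      rw [realMem_setReal_self]
      simp only [RealExpr.eval, NatExpr.eval, hvl, hvm, hs₁.mulW l hl.le]
      simp [t]
  have hs₁ := hs.of_agree ha₁ (by decide) (by decide)
  refine (Runs.forLoop (fun t s' => ∃ (P : Matrix (Fin (k * (d + 1) + 1)) (Fin (k * (d + 1) + 1)) ℝ)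
        (S : Set (Fin (k * (d + 1) + 1) → ℝ)), HoldsMatrix s' P ∧ IsProjection P S ∧
        ∀ z : ℕ → ℝ, (∀ r ∈ S, ∑ l : Fin (k * (d + 1)), r l.castSucc * z l + r (Fin.last _) = 0) ↔
          Solves X Y n d k t ph st D zo a z) (by decide) (by decide) hs₁.eqs hV.eqs
    (fun _ _ _ h => h) ⟨1, ∅, fun l m => ?_, isProjection_one, fun z => by simp [Solves]⟩ ?_)
  · rw [h₁ l l.2 m m.2, Matrix.one_apply]
    simp [Fin.ext_iff]
  rintro t ht s₂ ha₂ hvt ⟨P, S, hP, hproj, hS⟩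
  have hs₂ := hs₁.of_agree ha₂ (by decide) (by decide)
  have e45 : s₂.natMem 45 0 = st := by rw [ha₂.1 45 (by decide), ha₁.1 45 (by decide), hst]
  have e31 : s₂.natMem 31 = D := by rw [ha₂.1 31 (by decide), ha₁.1 31 (by decide), hD]
  have e46 : s₂.natMem 46 0 = ph := by rw [ha₂.1 46 (by decide), ha₁.1 46 (by decide), hph]
  have e20 : s₂.realMem 20 = zo := by rw [ha₂.2 20 (by decide), ha₁.2 20 (by decide), hzo]
  have e17 : s₂.realMem 17 = a := by rw [ha₂.2 17 (by decide), ha₁.2 17 (by decide), ha]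
  set i := min (D (st + (t + t))) (n - 1) with hi
  set h := D (st + (t + t) + 1) with hh
  have hin : i < n := by have := hV.hn; omega
  refine Runs.seq (Q₁ := fun s' => s'.natMem 37 0 = i ∧ s'.realMem = s₂.realMem) (.storeNat ⟨?_, rfl⟩)
    fun s₃ ha₃ h₃ => ?_
  -- With truncated subtraction, `x - (x - (n - 1))` is the minimum of `x` and `n - 1`; this cap
  -- turns arbitrary digits into valid point indices.
  · rw [natMem_setNat_self]
    simp only [NatExpr.eval, e45, e31, hvt, hs₂.points, Function.update_self]
    omega
  refine Runs.seq (Q₁ := fun s' => s'.natMem 38 0 = h ∧ s'.realMem = s₂.realMem)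
    (.storeNat ⟨?_, h₃.2⟩) fun s₄ ha₄ h₄ => ?_
  · rw [natMem_setNat_self]
    simp only [NatExpr.eval, ha₃.1 45 (by decide), ha₃.1 31 (by decide), ha₃.1 36 (by decide), e45,
      e31, hvt, Function.update_self, hh]
  have hs₄ := (hs₂.of_agree ha₃ (by decide) (by decide)).of_agree ha₄ (by decide) (by decide)
  have e37 : s₄.natMem 37 0 = i := by rw [ha₄.1 37 (by decide), h₃.1]
  refine Runs.seq (eqProg_runs hV hs₄ e37 hin h₄.1
    (ph := ph) (by rw [ha₄.1 46 (by decide), ha₃.1 46 (by decide), e46])) fun s₅ ha₅ h₅ => ?_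
  have hs₅ := hs₄.of_agree ha₅ (by decide) (by decide)
  rw [h₄.2, e20, e17] at h₅
  refine Runs.seq (rowProg_runs hV hs₅ (by rw [ha₅.1 37 (by decide), e37]) hin h₅.1)
    fun s₆ ha₆ h₆ => ?_
  have hs₆ := hs₅.of_agree ha₆ (by decide) (by decide)
  have hP₆ : HoldsMatrix s₆ P := by
    intro l m
    rw [ha₆.2 11 (by decide), ha₅.2 11 (by decide), h₄.2, hP l m]
  refine (projProg_runs hV hs₆ rfl hP₆).imp fun s₇ _ h₇ => ⟨_, _, h₇, hproj.step _, fun z => ?_⟩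
  rw [Set.forall_mem_insert, hS z, h₆ z, h₅.2, sub_eq_zero]
  constructor
  · rintro ⟨h1, h2⟩ t' ht'
    rcases Nat.lt_succ_iff_lt_or_eq.1 ht' with ht' | rfl
    · exact h2 t' ht'
    · exact h1
  · exact fun h0 => ⟨h0 t (Nat.lt_succ_self t), fun t' ht' => h0 t' (by omega)⟩

/-- Solve one of the two linear systems and write the solution to the bank `zb`. -/
def phaseProg (zb ph : ℕ) (st : NatExpr) : Program :=
  .seq (.storeNat 46 (.const 0) (.const ph)) (.seq (.storeNat 45 (.const 0) st)
    (.seq solveProg (forLoop 42 7 (.storeReal zb (nv 42)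
      (.div (.read 11 (.add (.read 17 (nv 7)) (nv 42)))
        (.read 11 (.add (.read 17 (nv 7)) (nv 7))))))))

/-- The entries of the last row of the projection are divided by its last entry, as in
`IsProjection.solution`. For an insoluble system the result is arbitrary, hence the conditional
conclusion. The position `st` is evaluated after the phase number has been stored, which explains
the state in `hst`. -/
theorem phaseProg_runs (hV : SizeBound V n d k) (hs : Env n d k X Y γ s) {zb ph p : ℕ}
    {st : NatExpr} (hzb : zb ≠ 11) {D : ℕ → ℕ} {zo a : ℕ → ℝ}
    (hst : st.eval (s.setNat 46 0 ph) = p) (hD : s.natMem 31 = D)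
    (hzo : s.realMem 20 = zo) (ha : s.realMem 17 = a) :
    Runs V L (phaseProg zb ph st) s fun s' =>
      (∃ z, Solves X Y n d k (eqCount n d k) ph p D zo a z) →
        Solves X Y n d k (eqCount n d k) ph p D zo a (s'.realMem zb) := by
  refine Runs.seq (Q₁ := fun s' => s' = s.setNat 46 0 ph) (.storeNat rfl) fun s₁ ha₁ h₁ => ?_
  have ha₁ : Agree [46] [] s s₁ := ha₁
  refine Runs.seq (Q₁ := fun s' => s'.natMem 45 0 = p) (.storeNat ?_) fun s₂ ha₂ h₂ => ?_
  · rw [natMem_setNat_self, h₁, hst]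
    simp [NatExpr.eval]
  have ha₂ : Agree [45] [] s₁ s₂ := ha₂
  have hs₂ := (hs.of_agree ha₁ (by decide) (by decide)).of_agree ha₂ (by decide) (by decide)
  refine Runs.seq (solveProg_runs hV hs₂ (ph := ph) (D := D) (zo := zo) (a := a) ?_ h₂ ?_ ?_ ?_)
    fun s₃ ha₃ h₃ => ?_
  · rw [ha₂.1 46 (by decide), h₁]; simp
  · rw [ha₂.1 31 (by decide), ha₁.1 31 (by decide), hD]
  · rw [ha₂.2 20 (by decide), ha₁.2 20 (by decide), hzo]
  · rw [ha₂.2 17 (by decide), ha₁.2 17 (by decide), ha]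
  obtain ⟨P, S, hP, hproj, hS⟩ := h₃
  have hs₃ := hs₂.of_agree ha₃ (by decide) (by decide)
  refine (Runs.fill (m := zb) (base := 0) (fun l => s₃.realMem 11 (k * (d + 1) * (k * (d + 1) + 1) + l) /
    s₃.realMem 11 (k * (d + 1) * (k * (d + 1) + 1) + k * (d + 1)))
    (by simp [Program.natW]) (by simp [Program.natW]) hs₃.params
    ((Nat.le_succ _).trans hV.width) ?_).imp ?_
  · intro l hl s₄ ha₄ hvl _
    have ha₄ : Agree [42] [zb] s₃ s₄ := ha₄
    have e7 : s₄.natMem 7 0 = k * (d + 1) := by rw [ha₄.1 7 (by decide), hs₃.params]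
    have e11 : s₄.realMem 11 = s₃.realMem 11 := ha₄.2 11 (by simpa using hzb.symm)
    have e17 : s₄.natMem 17 (k * (d + 1)) = k * (d + 1) * (k * (d + 1) + 1) := by
      rw [ha₄.1 17 (by decide), hs₃.mulW _ (Nat.le_succ _)]
    refine .storeReal ?_
    rw [realMem_setReal_self]
    simp only [RealExpr.eval, NatExpr.eval, hvl, e7, e11, e17, zero_add]
  · rintro s₄ - ⟨h₄, -⟩ ⟨z, hz⟩
    rw [← hS] at hz ⊢
    intro r hr
    rw [← hproj.solution (fun l => z l) hz r hr]
    congr 1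
    refine Finset.sum_congr rfl fun l _ => ?_
    have := h₄ l l.2
    rw [zero_add] at this
    rw [this, ← hP, ← hP]
    rfl

end

/-! ### Decoding, evaluating and comparing candidates -/

section

variable {V n d k : ℕ} {X Y : ℕ → ℝ} {γ : ℝ} {L : ℝ → ℝ → ℝ} {s s' : State}

theorem SizeBound.base_pos (hV : SizeBound V n d k) : 0 < digitBase n k :=
  hV.hn.trans hV.n_le_base

/-- Divide the content of the variable `32` by the base, with the quotient in the variable `33`. -/
def divProg : Program :=
  .seq (.storeNat 33 (.const 0) (.const 0))
    (forLoop 35 12 (.cond (.natLe (nv 10) (nv 32))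
      (.seq (.storeNat 32 (.const 0) (.sub (nv 32) (nv 10)))
        (.storeNat 33 (.const 0) (.add (nv 33) (.const 1)))) .skip))

/-- Division by repeated subtraction, with a fixed number of rounds. In the invariant, either the
remainder is already below the base or every round so far has subtracted. -/
theorem divProg_runs (hV : SizeBound V n d k) (hs : Env n d k X Y γ s) {c : ℕ}
    (hc : s.natMem 32 0 = c) (hlt : c < candCount n d k) :
    Runs V L divProg s fun s' =>
      s'.natMem 32 0 = c % digitBase n k ∧ s'.natMem 33 0 = c / digitBase n k := by
  have hB := hV.base_pos
  refine Runs.seq (Q₁ := fun s' => s'.natMem 33 0 = 0)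
    (.storeNat (by simp [NatExpr.eval])) fun s₁ ha₁ h₁ => ?_
  have hs₁ := hs.of_agree ha₁ (by decide) (by decide)
  refine (Runs.forLoop (fun u s' => s'.natMem 32 0 + digitBase n k * s'.natMem 33 0 = c ∧
    (s'.natMem 32 0 < digitBase n k ∨ s'.natMem 33 0 = u)) (by decide) (by decide) hs₁.cands
    hV.cands ?_ ?_ ?_).imp ?_
  · intro u s' x h
    simpa only [natMem_setNat_of_ne s' (show 32 ≠ 35 by decide),
      natMem_setNat_of_ne s' (show 33 ≠ 35 by decide)] using h
  · rw [ha₁.1 32 (by decide), hc, h₁]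
    exact ⟨by simp, Or.inr rfl⟩
  · intro u hu s₂ ha₂ _ h₂
    have hs₂ := hs₁.of_agree ha₂ (by decide) (by decide)
    refine .cond (fun t => ?_) fun t => .skip ?_
    · simp only [Test.Holds, NatExpr.eval, hs₂.base] at t
      refine Runs.seq (Q₁ := fun s' => s'.natMem 32 0 = s₂.natMem 32 0 - digitBase n k ∧
        s'.natMem 33 0 = s₂.natMem 33 0) (.storeNat ?_) fun s₃ ha₃ h₃ => .storeNat ?_
      · simp [NatExpr.eval, hs₂.base, natMem_setNat_of_ne _ (show 33 ≠ 32 by decide)]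
      · rw [natMem_setNat_self, natMem_setNat_of_ne _ (show 32 ≠ 33 by decide), h₃.1]
        simp only [NatExpr.eval, h₃.2, Function.update_self]
        rcases h₂ with ⟨h₂, h₂' | h₂'⟩
        · omega
        · refine ⟨?_, Or.inr (by omega)⟩
          rw [mul_add, mul_one]
          omega
    · simp only [Test.Holds, NatExpr.eval, hs₂.base, not_le] at t
      exact ⟨h₂.1, Or.inl t⟩
  -- Had all `candCount` rounds subtracted, `c` would be at least the base times `candCount`,
  -- contrary to `hlt`.
  · rintro s₂ - ⟨h, h'⟩
    have hr : s₂.natMem 32 0 < digitBase n k := by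
      rcases h' with h' | h'
      · exact h'
      · rw [h'] at h
        have := Nat.le_mul_of_pos_left (candCount n d k) hB
        omega
    obtain ⟨h1, h2⟩ := (Nat.div_mod_unique hB).2 ⟨h, hr⟩
    exact ⟨h2.symm, h1.symm⟩

/-- Write the digits of the content of the variable `30` to the bank `31`. -/
def decodeProg : Program :=
  .seq (.storeNat 32 (.const 0) (nv 30))
    (forLoop 34 11 (.seq divProg (.seq (.storeNat 31 (nv 34) (nv 32))
      (.storeNat 32 (.const 0) (nv 33)))))

theorem decodeProg_runs (hV : SizeBound V n d k) (hs : Env n d k X Y γ s) {c : ℕ}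
    (hc : s.natMem 30 0 = c) (hlt : c < candCount n d k) :
    Runs V L decodeProg s fun s' => ∀ t < digitCount n d k,
      s'.natMem 31 t = c / digitBase n k ^ t % digitBase n k := by
  refine Runs.seq (Q₁ := fun s' => s'.natMem 32 0 = c)
    (.storeNat (by simp [NatExpr.eval, hc])) fun s₁ ha₁ h₁ => ?_
  have hs₁ := hs.of_agree ha₁ (by decide) (by decide)
  refine (Runs.forLoop (fun t s' => s'.natMem 32 0 = c / digitBase n k ^ t ∧
    ∀ t' < t, s'.natMem 31 t' = c / digitBase n k ^ t' % digitBase n k) (by decide) (by decide)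
    hs₁.digits hV.digits ?_ (by simpa using h₁) ?_).imp fun s' _ h => h.2
  · intro u s' x h
    simpa only [natMem_setNat_of_ne s' (show 32 ≠ 34 by decide),
      natMem_setNat_of_ne s' (show 31 ≠ 34 by decide)] using h
  · rintro t ht s₂ ha₂ hvt ⟨h₂, h₂'⟩
    have hs₂ := hs₁.of_agree ha₂ (by decide) (by decide)
    refine Runs.seq (divProg_runs hV hs₂ h₂ ((Nat.div_le_self _ _).trans_lt hlt))
      fun s₃ ha₃ h₃ => ?_
    refine Runs.seq (Q₁ := fun s' => s'.natMem 33 0 = c / digitBase n k ^ (t + 1) ∧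
      ∀ t' < t + 1, s'.natMem 31 t' = c / digitBase n k ^ t' % digitBase n k) (.storeNat ?_)
      fun s₄ ha₄ h₄ => .storeNat ?_
    · rw [natMem_setNat_of_ne _ (show 33 ≠ 31 by decide), h₃.2, Nat.div_div_eq_div_mul, ← pow_succ]
      refine ⟨rfl, fun t' ht' => ?_⟩
      simp only [natMem_setNat_self, NatExpr.eval, ha₃.1 34 (by decide), hvt, h₃.1,
        ha₃.1 31 (by decide)]
      rcases Nat.lt_succ_iff_lt_or_eq.1 ht' with ht' | rfl
      · rw [Function.update_of_ne (by omega), h₂' t' ht']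
      · rw [Function.update_self]
    · rw [natMem_setNat_self, natMem_setNat_of_ne _ (show 31 ≠ 32 by decide)]
      simpa [NatExpr.eval] using h₄

/-- Compute the coefficients of the candidate. -/
def signProg : Program :=
  forLoop 39 2 (.cond
    (.natLe (.read 31 (.add (.add (.add (nv 6) (nv 6)) (.add (nv 6) (nv 6))) (nv 39))) (.const 0))
    (.storeReal 17 (nv 39) (.sub (.const 0) (.const 1))) (.storeReal 17 (nv 39) (.const 1)))

theorem signProg_runs (hV : SizeBound V n d k) (hs : Env n d k X Y γ s) :
    Runs V L signProg s fun s' => ∀ j < k, s'.realMem 17 j =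
      if s.natMem 31 (eqCount n d k + eqCount n d k + (eqCount n d k + eqCount n d k) + j) = 0
        then -1 else 1 := by
  refine (Runs.fill (m := 17) (base := 0) (fun j =>
    if s.natMem 31 (eqCount n d k + eqCount n d k + (eqCount n d k + eqCount n d k) + j) = 0
      then -1 else 1) (by decide) (by decide) hs.neurons hV.neurons ?_).imp
    fun s' _ h j hj => by simpa using h.1 j hj
  intro j hj s₁ ha₁ hvj _
  have hs₁ := hs.of_agree ha₁ (by decide) (by decide)
  refine .cond (fun t => .storeReal ?_) fun t => .storeReal ?_
  all_goals
    simp only [Test.Holds, NatExpr.eval, hs₁.eqs, hvj, ha₁.1 31 (by decide), Nat.le_zero] at t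
    rw [realMem_setReal_self]
    simp [RealExpr.eval, NatExpr.eval, hvj, t]

/-- Compute the training error of the candidate. -/
def lossProg : Program :=
  .seq (.storeReal 19 (.const 0) (.const 0))
    (forLoop 44 0 (.seq (.storeReal 24 (.const 0) (.const 0))
      (.seq (forLoop 39 2 (.seq (preactProg 15 39 44) (.cond (.realLe (.const 0) (rv 13))
        (.storeReal 24 (.const 0) (.add (rv 24) (.mul (.read 17 (nv 39)) (rv 13)))) .skip)))
        (.storeReal 19 (.const 0) (.add (rv 19) (.loss (rv 24) (.read 1 (nv 44))))))))

theorem lossProg_runs (hV : SizeBound V n d k) (hs : Env n d k X Y γ s) :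
    Runs V L lossProg s fun s' =>
      s'.realMem 19 0 = totalLoss L X Y n d k (s.realMem 17) (s.realMem 15) := by
  refine Runs.seq (Q₁ := fun s' => s'.realMem 19 0 = 0)
    (.storeReal (by simp [NatExpr.eval, RealExpr.eval])) fun s₁ ha₁ h₁ => ?_
  have hs₁ := hs.of_agree ha₁ (by decide) (by decide)
  refine Runs.forLoop (fun i s' => s'.realMem 19 0 =
    ∑ i ∈ range i, L (output X d k (s.realMem 17) (s.realMem 15) i) (Y i)) (by decide) (by decide)
    hs₁.points hV.points (fun _ _ _ h => h) (by simpa using h₁) ?_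
  intro i hi s₂ ha₂ hvi h₂
  have hs₂ := hs₁.of_agree ha₂ (by decide) (by decide)
  refine Runs.seq (Q₁ := fun s' => s'.realMem 24 0 = 0)
    (.storeReal (by simp [NatExpr.eval, RealExpr.eval])) fun s₃ ha₃ h₃ => ?_
  have hs₃ := hs₂.of_agree ha₃ (by decide) (by decide)
  refine Runs.seq (Runs.forLoop (fun j s' => s'.realMem 24 0 =
    ∑ j ∈ range j, s.realMem 17 j * max 0 (preact X d j i (s.realMem 15))) (by decide) (by decide)
    hs₃.neurons hV.neurons (fun _ _ _ h => h) (by simpa using h₃) ?_) fun s₄ ha₄ h₄ => ?_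
  · intro j hj s₄ ha₄ hvj h₄
    have hs₄ := hs₃.of_agree ha₄ (by decide) (by decide)
    refine Runs.seq (preactProg_runs hV hs₄ (by decide) (by decide) (by decide) hvj (i := i)
      (by rw [ha₄.1 44 (by decide), ha₃.1 44 (by decide), hvi]) hj hi) fun s₅ ha₅ h₅ => ?_
    rw [ha₄.2 15 (by decide), ha₃.2 15 (by decide), ha₂.2 15 (by decide),
      ha₁.2 15 (by decide)] at h₅
    have e24 : s₅.realMem 24 = s₄.realMem 24 := ha₅.2 24 (by decide)
    have e17 : s₅.realMem 17 = s.realMem 17 := by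
      rw [ha₅.2 17 (by decide), ha₄.2 17 (by decide), ha₃.2 17 (by decide), ha₂.2 17 (by decide),
        ha₁.2 17 (by decide)]
    have e39 : s₅.natMem 39 0 = j := by rw [ha₅.1 39 (by decide), hvj]
    refine .cond (fun t => .storeReal ?_) fun t => .skip ?_
    · simp only [Test.Holds, RealExpr.eval, NatExpr.eval, h₅, Nat.cast_zero] at t
      rw [realMem_setReal_self]
      simp only [RealExpr.eval, NatExpr.eval, Function.update_self, e24, h₄, e17, e39, h₅,
        Finset.sum_range_succ, max_eq_right t]
    · simp only [Test.Holds, RealExpr.eval, NatExpr.eval, h₅, Nat.cast_zero, not_le] at t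
      rw [e24, h₄, Finset.sum_range_succ, max_eq_left t.le, mul_zero, add_zero]
  · have hs₄ := hs₃.of_agree ha₄ (by decide) (by decide)
    refine .storeReal ?_
    rw [realMem_setReal_self]
    simp only [RealExpr.eval, NatExpr.eval, Function.update_self, h₄, hs₄.y,
      ha₄.2 19 (by decide), ha₃.2 19 (by decide), h₂, ha₄.1 44 (by decide), ha₃.1 44 (by decide),
      hvi, Finset.sum_range_succ, output]

/-- The banks `3`, `4`, `5` hold the weights `z` and the coefficients `a` as output. -/
def HoldsOutput (d k : ℕ) (a z : ℕ → ℝ) (s : State) : Prop :=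
  ∀ j < k, (∀ l < d, s.realMem 3 (j * d + l) = z (j * (d + 1) + l)) ∧
    s.realMem 4 j = z (j * (d + 1) + d) ∧ s.realMem 5 j = a j

/-- Copy the candidate to the output. -/
def copyProg : Program :=
  forLoop 39 2 (.seq
    (forLoop 42 1 (.storeReal 3 (.add (.read 14 (nv 39)) (nv 42))
      (.read 15 (.add (.read 15 (nv 39)) (nv 42)))))
    (.seq (.storeReal 4 (nv 39) (.read 15 (.add (.read 15 (nv 39)) (nv 1))))
      (.storeReal 5 (nv 39) (.read 17 (nv 39)))))

theorem copyProg_runs (hV : SizeBound V n d k) (hs : Env n d k X Y γ s) :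
    Runs V L copyProg s (HoldsOutput d k (s.realMem 17) (s.realMem 15)) := by
  have hb := hV.k_le_base
  refine Runs.forLoop (fun j s' => HoldsOutput d j (s.realMem 17) (s.realMem 15) s') (by decide)
    (by decide) hs.neurons hV.neurons (fun _ _ _ h => h) (fun j hj => absurd hj (Nat.not_lt_zero j)) ?_
  intro j hj s₁ ha₁ hvj h₁
  have hs₁ := hs.of_agree ha₁ (by decide) (by decide)
  refine Runs.seq (Runs.fill (m := 3) (base := j * d) (fun l => s.realMem 15 (j * (d + 1) + l))
      (by decide) (by decide) hs₁.dim hV.dim ?_) fun s₂ ha₂ h₂ => ?_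
  · intro l _ s₂ ha₂ hl _
    have hs₂ := hs₁.of_agree ha₂ (by decide) (by decide)
    refine .storeReal ?_
    rw [realMem_setReal_self]
    simp only [RealExpr.eval, NatExpr.eval, hl, ha₂.1 39 (by decide), hvj, hs₂.mulE j hj.le,
      hs₂.mulD j (by omega), ha₂.2 15 (by decide), ha₁.2 15 (by decide)]
  have hs₂ := hs₁.of_agree ha₂ (by decide) (by decide)
  refine Runs.seq (Q₁ := fun s' => s'.realMem 4 = Function.update (s₁.realMem 4) j
    (s.realMem 15 (j * (d + 1) + d))) (.storeReal ?_) fun s₃ ha₃ h₃ => .storeReal ?_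
  · rw [realMem_setReal_self]
    simp only [RealExpr.eval, NatExpr.eval, ha₂.1 39 (by decide), hvj, hs₂.mulE j hj.le, hs₂.dim,
      ha₂.2 15 (by decide), ha₁.2 15 (by decide), ha₂.2 4 (by decide)]
  · intro j' hj'
    rw [realMem_setReal_self, realMem_setReal_of_ne _ (show 3 ≠ 5 by decide),
      realMem_setReal_of_ne _ (show 4 ≠ 5 by decide), h₃, ha₃.2 3 (by decide)]
    simp only [RealExpr.eval, NatExpr.eval, ha₃.1 39 (by decide), ha₂.1 39 (by decide), hvj,
      ha₃.2 17 (by decide), ha₂.2 17 (by decide), ha₁.2 17 (by decide), ha₃.2 5 (by decide),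
      ha₂.2 5 (by decide)]
    rcases Nat.lt_succ_iff_lt_or_eq.1 hj' with hj' | rfl
    · obtain ⟨h4, h5, h6⟩ := h₁ j' hj'
      rw [Function.update_of_ne (by omega), Function.update_of_ne (by omega)]
      refine ⟨fun l hl => ?_, h5, h6⟩
      rw [h₂.2 _ (Or.inl ?_), h4 l hl]
      calc j' * d + l < (j' + 1) * d := by rw [add_mul]; omega
        _ ≤ j * d := Nat.mul_le_mul_right _ hj'
    · exact ⟨h₂.1, Function.update_self _ _ _, Function.update_self _ _ _⟩

/-- Process the candidate with the number in the variable `30`. -/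
def candProg : Program :=
  .seq decodeProg (.seq signProg (.seq (phaseProg 20 0 (.const 0))
    (.seq (phaseProg 15 1 (.add (nv 6) (nv 6))) (.seq lossProg
      (.cond (.and (.natLe (.const 1) (nv 50)) (.realLe (rv 18) (rv 19))) .skip
        (.seq (.storeNat 50 (.const 0) (.const 1))
          (.seq (.storeReal 18 (.const 0) (rv 19)) copyProg)))))))

/-- The output is at least as good as the first `c` candidates; if `c = 0`, there may be no output
yet. -/
def BestSoFar (L : ℝ → ℝ → ℝ) (X Y : ℕ → ℝ) (n d k c : ℕ) (s : State) : Prop :=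
  (s.natMem 50 0 = 0 ∧ c = 0) ∨ (s.natMem 50 0 = 1 ∧ ∃ a z, (∀ j < k, a j = -1 ∨ a j = 1) ∧
    HoldsOutput d k a z s ∧ s.realMem 18 0 = totalLoss L X Y n d k a z ∧
    ∀ c' < c, ∃ D a' z', (∀ t < digitCount n d k, D t = c' / digitBase n k ^ t % digitBase n k) ∧
      IsCandidate X Y n d k (eqCount n d k) D a' z' ∧
      s.realMem 18 0 ≤ totalLoss L X Y n d k a' z')

/-- The recorded value is the true training error of the weights actually computed, whether or not
the two systems were soluble, so the stored optimum is always attained. Cell 0 of the natural bank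
`50` tells whether there is an output to compare with. -/
theorem candProg_runs (hV : SizeBound V n d k) (hs : Env n d k X Y γ s) {c : ℕ}
    (hc : s.natMem 30 0 = c) (hlt : c < candCount n d k) (hbest : BestSoFar L X Y n d k c s) :
    Runs V L candProg s (BestSoFar L X Y n d k (c + 1)) := by
  refine Runs.seq (decodeProg_runs hV hs hc hlt) fun s₁ ha₁ h₁ => ?_
  have hs₁ := hs.of_agree ha₁ (by decide) (by decide)
  refine Runs.seq (signProg_runs hV hs₁) fun s₂ ha₂ h₂ => ?_
  have hs₂ := hs₁.of_agree ha₂ (by decide) (by decide)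
  refine Runs.seq (phaseProg_runs hV hs₂ (by decide) (p := 0) rfl rfl rfl rfl) fun s₃ ha₃ h₃ => ?_
  have hs₃ := hs₂.of_agree ha₃ (by decide) (by decide)
  refine Runs.seq (phaseProg_runs hV hs₃ (by decide) (p := eqCount n d k + eqCount n d k)
    (by simp only [NatExpr.eval, natMem_setNat_of_ne s₃ (show 6 ≠ 46 by decide), hs₃.eqs])
    rfl rfl rfl) fun s₄ ha₄ h₄ => ?_
  have hs₄ := hs₃.of_agree ha₄ (by decide) (by decide)
  refine Runs.seq (lossProg_runs hV hs₄) fun s₅ ha₅ h₅ => ?_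
  have hs₅ := hs₄.of_agree ha₅ (by decide) (by decide)
  have A := ha₁.trans (ha₂.trans (ha₃.trans (ha₄.trans ha₅)))
  have e31 : s₃.natMem 31 = s₁.natMem 31 := by rw [ha₃.1 31 (by decide), ha₂.1 31 (by decide)]
  have e17 : s₄.realMem 17 = s₂.realMem 17 := by rw [ha₄.2 17 (by decide), ha₃.2 17 (by decide)]
  have hcand : IsCandidate X Y n d k (eqCount n d k) (s₁.natMem 31) (s₄.realMem 17)
      (s₄.realMem 15) := by
    refine ⟨fun j hj => by rw [e17, h₂ j hj], s₂.realMem 20, s₃.realMem 20, ?_, ?_⟩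
    · rw [e17, ← ha₂.1 31 (by decide)]
      exact h₃
    · rw [← e31, ha₄.2 17 (by decide)]
      exact h₄
  have hsign : ∀ j < k, s₄.realMem 17 j = -1 ∨ s₄.realMem 17 j = 1 := by
    intro j hj
    rw [hcand.1 j hj]
    split_ifs <;> simp
  have e17' : s₅.realMem 17 = s₄.realMem 17 := ha₅.2 17 (by decide)
  have e15' : s₅.realMem 15 = s₄.realMem 15 := ha₅.2 15 (by decide)
  have e50 : s₅.natMem 50 = s.natMem 50 := A.1 50 (by decide)
  have e18 : s₅.realMem 18 = s.realMem 18 := A.2 18 (by decide)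
  refine .cond (fun t => .skip ?_) fun t => ?_
  · simp only [Test.Holds, NatExpr.eval, RealExpr.eval, e50, e18, h₅] at t
    rcases hbest with hbest | ⟨hb50, a, z, ha, hout, hval, hall⟩
    · omega
    refine Or.inr ⟨by rw [e50, hb50], a, z, ha, ?_, by rw [e18, hval], fun c' hc' => ?_⟩
    · intro j hj
      rw [A.2 3 (by decide), A.2 4 (by decide), A.2 5 (by decide)]
      exact hout j hj
    · rw [e18]
      rcases Nat.lt_succ_iff_lt_or_eq.1 hc' with hc' | rfl
      · exact hall c' hc'
      · exact ⟨_, _, _, h₁, hcand, t.2⟩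
  · simp only [Test.Holds, NatExpr.eval, RealExpr.eval, e50, e18, h₅] at t
    refine Runs.seq (Q₁ := fun s' => s'.natMem 50 0 = 1) (.storeNat (by simp [NatExpr.eval]))
      fun s₆ ha₆ h₆ => ?_
    refine Runs.seq (Q₁ := fun s' => s'.realMem 18 0 =
      totalLoss L X Y n d k (s₄.realMem 17) (s₄.realMem 15)) (.storeReal ?_) fun s₇ ha₇ h₇ => ?_
    · rw [realMem_setReal_self]
      simp only [NatExpr.eval, RealExpr.eval, Function.update_self, ha₆.2 19 (by decide), h₅]
    have hs₇ := (hs₅.of_agree ha₆ (by decide) (by decide)).of_agree ha₇ (by decide) (by decide)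
    refine (copyProg_runs hV hs₇).imp fun s₈ ha₈ h₈ => ?_
    rw [ha₇.2 17 (by decide), ha₆.2 17 (by decide), e17', ha₇.2 15 (by decide),
      ha₆.2 15 (by decide), e15'] at h₈
    refine Or.inr ⟨by rw [ha₈.1 50 (by decide), ha₇.1 50 (by decide), h₆], _, _, hsign, h₈,
      by rw [ha₈.2 18 (by decide), h₇], fun c' hc' => ?_⟩
    rw [ha₈.2 18 (by decide), h₇]
    rcases Nat.lt_succ_iff_lt_or_eq.1 hc' with hc' | rfl
    · rcases hbest with hbest | ⟨hb50, a, z, ha, hout, hval, hall⟩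
      · omega
      obtain ⟨D, a', z', hD, hcand', hle⟩ := hall c' hc'
      refine ⟨D, a', z', hD, hcand', le_trans ?_ hle⟩
      by_contra! hcon
      exact t ⟨by omega, hcon.le⟩
    · exact ⟨_, _, _, h₁, hcand, le_rfl⟩

end

/-! ### Setup and the whole algorithm -/

section

variable {V n d k : ℕ} {X Y : ℕ → ℝ} {γ : ℝ} {L : ℝ → ℝ → ℝ} {s s' : State}

/-- Compute the numbers and tables that depend only on `n`, `d`, `k`. -/
def setupProg : Program :=
  .seq (.storeNat 4 (.const 0) (.add (nv 1) (.const 1)))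
  (.seq (.storeNat 5 (.const 0) (.sub (nv 0) (.sub (nv 0) (nv 4))))
  (.seq (mulTable 40 2 15 4)
  (.seq (.storeNat 7 (.const 0) (.read 15 (nv 2)))
  (.seq (.storeNat 8 (.const 0) (.add (nv 7) (.const 1)))
  (.seq (mulTable 40 2 18 5)
  (.seq (.storeNat 6 (.const 0) (.read 18 (nv 2)))
  (.seq (mulTable 40 2 16 0)
  (.seq (.storeNat 10 (.const 0) (.add (.read 16 (nv 2)) (.read 16 (nv 2))))
  (.seq (.storeNat 11 (.const 0) (.add (.add (.add (nv 6) (nv 6)) (.add (nv 6) (nv 6))) (nv 2)))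
  (.seq (.storeNat 12 (.const 0) (.const 1))
  (.seq (forLoop 41 11 (.seq (mulTable 40 10 19 12) (.storeNat 12 (.const 0) (.read 19 (nv 10)))))
  (.seq (mulTable 40 10 14 1) (mulTable 40 8 17 8)))))))))))))

theorem setupProg_runs (hV : SizeBound V n d k) (hn : s.natMem 0 0 = n) (hd : s.natMem 1 0 = d)
    (hk : s.natMem 2 0 = k) :
    Runs V L setupProg s fun s' => Env n d k (s.realMem 0) (s.realMem 1) (s.realMem 2 0) s' := by
  refine Runs.seq (Q₁ := fun s' => s'.natMem 4 0 = d + 1)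
    (.storeNat (by simp [NatExpr.eval, hd])) fun s₁ a₁ h₁ => ?_
  refine Runs.seq (Q₁ := fun s' => s'.natMem 5 0 = min n (d + 1)) (.storeNat ?_) fun s₂ a₂ h₂ => ?_
  · simp only [natMem_setNat_self, NatExpr.eval, Function.update_self, h₁, a₁.1 0 (by decide), hn]
    omega
  have b₂ := a₁.trans a₂
  refine Runs.seq (Runs.mulTable (c := d + 1) (N := k) (by decide) (by decide) (by decide)
    (by rw [b₂.1 2 (by decide), hk]) hV.neurons (by rw [a₂.1 4 (by decide), h₁]))
    fun s₃ a₃ h₃ => ?_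
  have b₃ := b₂.trans a₃
  refine Runs.seq (Q₁ := fun s' => s'.natMem 7 0 = k * (d + 1)) (.storeNat ?_) fun s₄ a₄ h₄ => ?_
  · simp only [natMem_setNat_self, NatExpr.eval, Function.update_self, b₃.1 2 (by decide), hk,
      h₃ k le_rfl]
  refine Runs.seq (Q₁ := fun s' => s'.natMem 8 0 = k * (d + 1) + 1) (.storeNat ?_)
    fun s₅ a₅ h₅ => ?_
  · simp only [natMem_setNat_self, NatExpr.eval, Function.update_self, h₄]
  have b₅ := b₃.trans (a₄.trans a₅)
  have c₅ := a₃.trans (a₄.trans a₅)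
  refine Runs.seq (Runs.mulTable (c := min n (d + 1)) (N := k) (by decide) (by decide) (by decide)
    (by rw [b₅.1 2 (by decide), hk]) hV.neurons (by rw [c₅.1 5 (by decide), h₂]))
    fun s₆ a₆ h₆ => ?_
  have b₆ := b₅.trans a₆
  refine Runs.seq (Q₁ := fun s' => s'.natMem 6 0 = eqCount n d k) (.storeNat ?_)
    fun s₇ a₇ h₇ => ?_
  · simp only [natMem_setNat_self, NatExpr.eval, Function.update_self, b₆.1 2 (by decide), hk,
      h₆ k le_rfl, eqCount]
  have b₇ := b₆.trans a₇
  refine Runs.seq (Runs.mulTable (c := n) (N := k) (by decide) (by decide) (by decide)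
    (by rw [b₇.1 2 (by decide), hk]) hV.neurons (by rw [b₇.1 0 (by decide), hn]))
    fun s₈ a₈ h₈ => ?_
  have b₈ := b₇.trans a₈
  refine Runs.seq (Q₁ := fun s' => s'.natMem 10 0 = digitBase n k) (.storeNat ?_)
    fun s₉ a₉ h₉ => ?_
  · simp only [natMem_setNat_self, NatExpr.eval, Function.update_self, b₈.1 2 (by decide), hk,
      h₈ k le_rfl, digitBase]
  have b₉ := b₈.trans a₉
  refine Runs.seq (Q₁ := fun s' => s'.natMem 11 0 = digitCount n d k) (.storeNat ?_)
    fun s₁₀ a₁₀ h₁₀ => ?_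
  · simp only [natMem_setNat_self, NatExpr.eval, Function.update_self, b₉.1 2 (by decide), hk,
      (a₈.trans a₉).1 6 (by decide), h₇, digitCount]
  refine Runs.seq (Q₁ := fun s' => s'.natMem 12 0 = 1) (.storeNat (by simp [NatExpr.eval]))
    fun s₁₁ a₁₁ h₁₁ => ?_
  have c₁₁ := a₁₀.trans a₁₁
  refine Runs.seq (Runs.forLoop (N := digitCount n d k)
    (fun t s' => s'.natMem 12 0 = digitBase n k ^ t) (by decide)
    (by decide) (by rw [a₁₁.1 11 (by decide), h₁₀]) hV.digits ?_ (by simpa using h₁₁) ?_)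
    fun s₁₂ a₁₂ h₁₂ => ?_
  · intro t s' x h
    rw [natMem_setNat_of_ne s' (show 12 ≠ 41 by decide), h]
  · intro t ht s' a hvt h
    -- The power is built up one factor at a time: the last entry of the table of multiples of the
    -- current power is the next power.
    have e10 : s'.natMem 10 0 = digitBase n k := by
      rw [a.1 10 (by decide), c₁₁.1 10 (by decide), h₉]
    refine Runs.seq (Runs.mulTable (by decide) (by decide) (by decide) e10 hV.base h)
      fun s'' a' h' => .storeNat ?_
    simp only [natMem_setNat_self, NatExpr.eval, Function.update_self, a'.1 10 (by decide), e10,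
      h' _ le_rfl, pow_succ]
    ring
  have b₁₂ := b₉.trans (c₁₁.trans a₁₂)
  have c₁₂ := c₁₁.trans a₁₂
  refine Runs.seq (Runs.mulTable (c := d) (N := digitBase n k) (by decide) (by decide) (by decide)
    (by rw [c₁₂.1 10 (by decide), h₉]) hV.base (by rw [b₁₂.1 1 (by decide), hd]))
    fun s₁₃ a₁₃ h₁₃ => ?_
  have w₁₃ := a₆.trans (a₇.trans (a₈.trans (a₉.trans (c₁₂.trans a₁₃))))
  refine (Runs.mulTable (c := k * (d + 1) + 1) (N := k * (d + 1) + 1) (by decide) (by decide)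
    (by decide) (by rw [w₁₃.1 8 (by decide), h₅]) hV.width
    (by rw [w₁₃.1 8 (by decide), h₅])).imp fun s₁₄ a₁₄ h₁₄ => ?_
  have z₁₂ := a₁₃.trans a₁₄
  have z₉ := c₁₂.trans z₁₂
  have z₇ := a₈.trans (a₉.trans z₉)
  have z₅ := w₁₃.trans a₁₄
  have z := b₁₂.trans z₁₂
  exact
    { points := by rw [z.1 0 (by decide), hn]
      dim := by rw [z.1 1 (by decide), hd]
      neurons := by rw [z.1 2 (by decide), hk]
      eqs := by rw [z₇.1 6 (by decide), h₇]
      params := by rw [(a₅.trans z₅).1 7 (by decide), h₄]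
      width := by rw [z₅.1 8 (by decide), h₅]
      base := by rw [z₉.1 10 (by decide), h₉]
      digits := by rw [(a₁₁.trans (a₁₂.trans z₁₂)).1 11 (by decide), h₁₀]
      cands := by rw [z₁₂.1 12 (by decide), h₁₂, candCount]
      mulD := by rw [a₁₄.1 14 (by decide)]; exact h₁₃
      mulE := by rw [(a₄.trans (a₅.trans z₅)).1 15 (by decide)]; exact h₃
      mulW := h₁₄
      x := z.2 0 (by decide)
      y := z.2 1 (by decide)
      target := by rw [z.2 2 (by decide)] }

/-- The algorithm. It solves both the optimization problem and the decision problem. -/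
def trainProg : Program :=
  .seq setupProg (.seq (forLoop 30 12 candProg)
    (.cond (.realLe (rv 18) (rv 2)) (.storeNat 3 (.const 0) (.const 1))
      (.storeNat 3 (.const 0) (.const 0))))

/-- Only the first `digitCount` digits are tied to the number of the candidate, and no others are
used. -/
theorem IsCandidate.congr {M : ℕ} {D D' : ℕ → ℕ} {a z : ℕ → ℝ}
    (hD : ∀ t < M + M + (M + M) + k, D t = D' t) (h : IsCandidate X Y n d k M D a z) :
    IsCandidate X Y n d k M D' a z := by
  have hS : ∀ ph st zo z, st ≤ M + M →
      (Solves X Y n d k M ph st D zo a z ↔ Solves X Y n d k M ph st D' zo a z) :=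
    fun ph st zo z hst => forall₂_congr fun t ht => by
      rw [hD _ (by omega), hD _ (by omega)]
  obtain ⟨h1, zo, z₁, h2, h3⟩ := h
  refine ⟨fun j hj => by rw [h1 j hj, hD _ (by omega)], zo, z₁, ?_, ?_⟩
  · simpa only [hS 0 0 zo _ (Nat.zero_le _)] using h2
  · simpa only [hS 1 (M + M) z₁ _ le_rfl] using h3

/-- The loop yields the best of finitely many candidates. Each competitor is matched by a digit
sequence (`exists_digits`), and that sequence occurs as a number below `candCount`. -/
theorem trainProg_runs {ell : ℝ → ℝ} (hell : ConcaveOn ℝ (Set.Ici 0) ell)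
    (hpos : ∀ t, 0 ≤ t → 0 ≤ ell t) (hL : ∀ yhat y, L yhat y = ell |yhat - y|)
    (hV : SizeBound V n d k) (hn : s.natMem 0 0 = n) (hd : s.natMem 1 0 = d) (hk : s.natMem 2 0 = k)
    (h50 : s.natMem 50 0 = 0) (hX : s.realMem 0 = X) (hY : s.realMem 1 = Y)
    (hγ : s.realMem 2 0 = γ) :
    Runs V L trainProg s fun s' => ∃ a z, (∀ j < k, a j = -1 ∨ a j = 1) ∧ HoldsOutput d k a z s' ∧
      (∀ a' z', (∀ j < k, a' j = -1 ∨ a' j = 1) →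
        totalLoss L X Y n d k a z ≤ totalLoss L X Y n d k a' z') ∧
      s'.natMem 3 0 = if totalLoss L X Y n d k a z ≤ γ then 1 else 0 := by
  refine Runs.seq (setupProg_runs hV hn hd hk) fun s₁ ha₁ hs₁ => ?_
  rw [hX, hY, hγ] at hs₁
  refine Runs.seq (Runs.forLoop (BestSoFar L X Y n d k) (by decide) (by decide) hs₁.cands hV.cands
    ?_ (Or.inl ⟨by rw [ha₁.1 50 (by decide), h50], rfl⟩) ?_) fun s₂ ha₂ h₂ => ?_
  · intro c s' x h
    simpa only [BestSoFar, HoldsOutput, realMem_setNat,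
      natMem_setNat_of_ne s' (show 50 ≠ 30 by decide)] using h
  · intro c hc s' ha hvc h
    exact candProg_runs hV (hs₁.of_agree ha (by decide) (by decide)) hvc hc h
  have hs₂ := hs₁.of_agree ha₂ (by decide) (by decide)
  have hcand : 0 < candCount n d k := pow_pos hV.base_pos _
  rcases h₂ with h₂ | ⟨-, a, z, hsign, hout, hval, hall⟩
  · omega
  have hopt : ∀ a' z', (∀ j < k, a' j = -1 ∨ a' j = 1) →
      totalLoss L X Y n d k a z ≤ totalLoss L X Y n d k a' z' := by
    intro a' z' ha'
    obtain ⟨D, hD, hle⟩ := exists_digits hell hpos hL X Y (d := d) (M := eqCount n d k) rfl hV.hn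
      hV.hk a' z' ha'
    obtain ⟨c, hc, hcD⟩ := exists_number_of_digits (digitCount n d k) D hD
    obtain ⟨D', a'', z'', hD', hcand', hle'⟩ := hall c hc
    rw [hval] at hle'
    exact hle'.trans (hle a'' z'' (hcand'.congr fun t ht => by rw [hD' t ht, ← hcD t ht]; rfl))
  refine .cond (fun t => .storeNat ⟨a, z, hsign, hout, hopt, ?_⟩)
    fun t => .storeNat ⟨a, z, hsign, hout, hopt, ?_⟩
  all_goals
    simp only [Test.Holds, RealExpr.eval, NatExpr.eval, hval, hs₂.target] at t
    simp [NatExpr.eval, t]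

end

/-! ## Input and output -/

section

variable {n d k : ℕ} (x : Fin n → Fin d → ℝ) (y : Fin n → ℝ) (γ : ℝ)

theorem inputState_x (i : Fin n) (l : Fin d) : (inputState k x y γ).realMem 0 (i * d + l) = x i l := by
  have h : (i * d + l : ℕ) = (finProdFinEquiv (i, l) : ℕ) := by
    simp [finProdFinEquiv, add_comm, mul_comm]
  have hlt : (i * d + l : ℕ) < n * d := h ▸ Fin.is_lt _
  have h' : (⟨i * d + l, hlt⟩ : Fin (n * d)) = finProdFinEquiv (i, l) := Fin.ext h
  simp only [inputState, if_true, dif_pos hlt, h', Equiv.symm_apply_apply]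

theorem inputState_y (i : Fin n) : (inputState k x y γ).realMem 1 i = y i := by
  simp [inputState]

theorem trainingError_eq_totalLoss (L : ℝ → ℝ → ℝ) (θ : Params d k) {a z : ℕ → ℝ}
    (hw : ∀ (j : Fin k) (l : Fin d), z (j * (d + 1) + l) = θ.w j l)
    (hb : ∀ j : Fin k, z (j * (d + 1) + d) = θ.b j) (ha : ∀ j : Fin k, a j = θ.a j) :
    trainingError L x y θ = totalLoss L ((inputState k x y γ).realMem 0)
      ((inputState k x y γ).realMem 1) n d k a z := by
  simp only [trainingError, totalLoss, Params.predict, output, preact_apply, Finset.sum_range,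
    inputState_x, inputState_y, hw, hb, ha]

/-- Parameters as coefficients and weights in the memory. -/
theorem exists_memory (θ : Params d k) : ∃ a z : ℕ → ℝ,
    (∀ j < k, a j = -1 ∨ a j = 1) ∧ (∀ (j : Fin k) (l : Fin d), z (j * (d + 1) + l) = θ.w j l) ∧
    (∀ j : Fin k, z (j * (d + 1) + d) = θ.b j) ∧ ∀ j : Fin k, a j = θ.a j := by
  have hdiv : ∀ j l, l ≤ d → (j * (d + 1) + l) / (d + 1) = j := fun j l hl => by
    rw [add_comm, Nat.add_mul_div_right _ _ (Nat.succ_pos d), Nat.div_eq_of_lt (by omega), zero_add]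
  have hmod : ∀ j l, l ≤ d → (j * (d + 1) + l) % (d + 1) = l := fun j l hl => by
    rw [mul_comm, Nat.mul_add_mod, Nat.mod_eq_of_lt (by omega)]
  refine ⟨fun j => if h : j < k then θ.a ⟨j, h⟩ else 0,
    fun c => if h : c / (d + 1) < k then
      (if h' : c % (d + 1) < d then θ.w ⟨_, h⟩ ⟨_, h'⟩ else θ.b ⟨_, h⟩) else 0, ?_, ?_, ?_, ?_⟩
  · intro j hj
    simpa [hj] using θ.sign ⟨j, hj⟩
  · intro j l
    simp [hdiv j l l.2.le, hmod j l l.2.le]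
  · intro j
    simp [hdiv j d le_rfl, hmod j d le_rfl]
  · intro j
    simp

end

theorem trainProg_correct {L : ℝ → ℝ → ℝ} {ell : ℝ → ℝ} (hell : ConcaveOn ℝ (Set.Ici 0) ell)
    (hpos : ∀ t, 0 ≤ t → 0 ≤ ell t) (hL : ∀ yhat y, L yhat y = ell |yhat - y|) {V n d k : ℕ}
    (hV : SizeBound V n d k) (x : Fin n → Fin d → ℝ) (y : Fin n → ℝ) (γ : ℝ) :
    Runs V L trainProg (inputState k x y γ) fun s =>
      (∃ θ : Params d k, s.HoldsParams θ ∧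
        ∀ θ' : Params d k, trainingError L x y θ ≤ trainingError L x y θ') ∧
      (s.natMem 3 0 = 0 ∨ s.natMem 3 0 = 1) ∧
      (s.natMem 3 0 = 1 ↔ ∃ θ : Params d k, trainingError L x y θ ≤ γ) := by
  refine (trainProg_runs hell hpos hL hV (by simp [inputState]) (by simp [inputState])
    (by simp [inputState]) (by simp [inputState]) rfl rfl (γ := γ) (by simp [inputState])).imp ?_
  rintro s - ⟨a, z, hsign, hout, hopt, hans⟩
  let θ : Params d k :=
    { w := fun j l => z (j * (d + 1) + l)
      b := fun j => z (j * (d + 1) + d)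
      a := fun j => a j
      sign := fun j => hsign j j.2 }
  have hθ : trainingError L x y θ = _ :=
    trainingError_eq_totalLoss x y γ L θ (fun _ _ => rfl) (fun _ => rfl) fun _ => rfl
  have hmin : ∀ θ' : Params d k, trainingError L x y θ ≤ trainingError L x y θ' := by
    intro θ'
    obtain ⟨a', z', hs', hw, hb, ha⟩ := exists_memory θ'
    rw [hθ, trainingError_eq_totalLoss x y γ L θ' hw hb ha]
    exact hopt a' z' hs'
  refine ⟨⟨θ, ⟨fun j l => (hout j j.2).1 l l.2, fun j => (hout j j.2).2.1,
    fun j => (hout j j.2).2.2⟩, hmin⟩, ?_, ?_⟩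
  · rw [hans]; split_ifs <;> simp
  · rw [hans, ← hθ]
    constructor
    · intro h
      split_ifs at h with h'
      exact ⟨θ, h'⟩
    · rintro ⟨θ', h⟩
      rw [if_pos ((hmin θ').trans h)]

/-! ## The running time -/

/-- The count is at most `4 * k * (d + 1) + k = 4 * d * k + 5 * k`. -/
theorem digitCount_le {n d k : ℕ} (hd : 1 ≤ d) : digitCount n d k ≤ 9 * (d * k) := by
  have h : eqCount n d k ≤ k * (d + 1) := Nat.mul_le_mul_left _ (min_le_right _ _)
  have h' : k ≤ d * k := Nat.le_mul_of_pos_left k hd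
  rw [mul_add, mul_one, mul_comm k d] at h
  rw [digitCount]
  omega

/-- If `n * k ≥ 2`, the factor 2 of the base `2 * (n * k)` is absorbed by `2 * (n * k) ≤ (n * k) ^
2`. If `n * k = 1`, powers of `n * k` are useless, but then there is one equation per system thanks
to the minimum with `n`, hence 5 digits in base 2 and `32` candidates for every `d`. -/
theorem candCount_le {n d k : ℕ} (hn : 1 ≤ n) (hd : 1 ≤ d) (hk : 1 ≤ k) :
    candCount n d k ≤ 32 * (n * k) ^ (18 * (d * k)) := by
  have hbase : digitBase n k = 2 * (n * k) := by rw [digitBase]; ring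
  have hpos : 1 ≤ n * k := Nat.mul_pos hn hk
  rw [candCount, hbase]
  rcases Nat.lt_or_ge (n * k) 2 with h | h
  · have h1 : n * k = 1 := by omega
    obtain ⟨rfl, rfl⟩ : n = 1 ∧ k = 1 := by simpa using h1
    have : digitCount 1 d 1 = 5 := by
      rw [digitCount, eqCount, min_eq_left (by omega)]
    rw [this]
    norm_num
  · calc (2 * (n * k)) ^ digitCount n d k ≤ ((n * k) * (n * k)) ^ digitCount n d k := by gcongr
      _ = (n * k) ^ (2 * digitCount n d k) := by rw [← pow_two, ← pow_mul]
      _ ≤ (n * k) ^ (18 * (d * k)) :=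
          Nat.pow_le_pow_right hpos (by have := digitCount_le (n := n) (k := k) hd; omega)
      _ ≤ 32 * (n * k) ^ (18 * (d * k)) := Nat.le_mul_of_pos_left _ (by norm_num)

theorem sizeBound {n d k : ℕ} (hn : 1 ≤ n) (hd : 1 ≤ d) (hk : 1 ≤ k) :
    SizeBound (candCount n d k * (9 * (n * d * k))) n d k := by
  have hB : 0 < digitBase n k := Nat.add_pos_left (Nat.mul_pos hk hn) _
  have hc : 0 < candCount n d k := pow_pos hB _
  have hV : 9 * (n * d * k) ≤ candCount n d k * (9 * (n * d * k)) := Nat.le_mul_of_pos_left _ hc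
  have hdk : d * k ≤ n * d * k := by rw [mul_assoc]; exact Nat.le_mul_of_pos_left _ hn
  have hnk : n * k ≤ n * d * k := Nat.mul_le_mul_right _ (Nat.le_mul_of_pos_right _ hd)
  have h1 : n ≤ n * k := Nat.le_mul_of_pos_right _ hk
  have h2 : d ≤ d * k := Nat.le_mul_of_pos_right _ hk
  have h3 : k ≤ d * k := Nat.le_mul_of_pos_left _ hd
  have h4 := digitCount_le (n := n) (k := k) hd
  have h5 : digitBase n k = 2 * (n * k) := by rw [digitBase]; ring
  have h6 : k * (d + 1) = d * k + k := by ring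
  constructor
  · exact hn
  · exact hk
  · omega
  · omega
  · omega
  · rw [digitCount] at h4; omega
  · omega
  · omega
  · omega
  · exact Nat.le_mul_of_pos_right _ (by omega)

theorem solvableInXPTime_of_concave {L : ℝ → ℝ → ℝ} {ell : ℝ → ℝ}
    (hell : ConcaveOn ℝ (Set.Ici 0) ell) (hpos : ∀ t, 0 ≤ t → 0 ≤ ell t)
    (hL : ∀ yhat y, L yhat y = ell |yhat - y|) : SolvableInXPTime L := by
  obtain ⟨a, p, hap⟩ := trainProg.exists_time_le
  let q : MvPolynomial (Fin 3) ℕ := .C (a * 32 ^ p) *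
    (.C 9 * (.X 0 * .X 1 * .X 2)) ^ p
  have key : ∀ n d k : ℕ, 1 ≤ n → 1 ≤ d → 1 ≤ k →
      trainProg.time (candCount n d k * (9 * (n * d * k))) ≤
        2 ^ k * (n * k) ^ (18 * p * (d * k)) * MvPolynomial.eval ![n, d, k] q := by
    intro n d k hn hd hk
    have hq : MvPolynomial.eval ![n, d, k] q = a * 32 ^ p * (9 * (n * d * k)) ^ p := by
      simp [q]
    have hV := sizeBound hn hd hk
    calc trainProg.time (candCount n d k * (9 * (n * d * k)))
        ≤ a * (candCount n d k * (9 * (n * d * k))) ^ p := hap _ (hn.trans hV.points)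
      _ ≤ a * (32 * (n * k) ^ (18 * (d * k)) * (9 * (n * d * k))) ^ p := by
          gcongr
          exact candCount_le hn hd hk
      _ = 1 * ((n * k) ^ (18 * p * (d * k)) * (a * 32 ^ p * (9 * (n * d * k)) ^ p)) := by
          rw [mul_pow, mul_pow, ← pow_mul, show 18 * (d * k) * p = 18 * p * (d * k) by ring]
          ring
      -- The choice of signs is already paid for by the digits, so the factor `2 ^ k` is only used
      -- through `1 ≤ 2 ^ k`.
      _ ≤ 2 ^ k * ((n * k) ^ (18 * p * (d * k)) * (a * 32 ^ p * (9 * (n * d * k)) ^ p)) :=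
          Nat.mul_le_mul_right _ Nat.one_le_two_pow
      _ = _ := by rw [hq, ← mul_assoc (2 ^ k)]
  refine ⟨18 * p, q, ⟨trainProg, fun n d k hn hd hk x y => ?_⟩,
    trainProg, fun n d k hn hd hk x y γ => ?_⟩
  · obtain ⟨t, s, he, ht, h, -⟩ := trainProg_correct hell hpos hL (sizeBound hn hd hk) x y 0
    exact ⟨t, s, he, ht.trans (key n d k hn hd hk), h⟩
  · obtain ⟨t, s, he, ht, -, h⟩ := trainProg_correct hell hpos hL (sizeBound hn hd hk) x y γ
    exact ⟨t, s, he, ht.trans (key n d k hn hd hk), h⟩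

/-! ### The losses with exponent `0 ≤ p < 1` -/

theorem concaveOn_ite_zero_one : ConcaveOn ℝ (Set.Ici 0) fun t : ℝ => if t = 0 then (0 : ℝ) else 1 := by
  refine ⟨convex_Ici 0, fun u hu v hv a b ha hb hab => ?_⟩
  have hu : 0 ≤ u := hu
  have hv : 0 ≤ v := hv
  simp only [smul_eq_mul]
  -- A convex combination of nonnegative numbers vanishes only if every number with positive weight
  -- does; otherwise the value is `1 = a + b`, which bounds the combination of values.
  by_cases h : a * u + b * v = 0
  · have h1 : a * u = 0 := by nlinarith [mul_nonneg ha hu, mul_nonneg hb hv]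
    have h2 : b * v = 0 := by nlinarith [mul_nonneg ha hu, mul_nonneg hb hv]
    rw [if_pos h]
    rcases mul_eq_zero.1 h1 with rfl | rfl <;> rcases mul_eq_zero.1 h2 with rfl | rfl <;>
      simp
  · rw [if_neg h, ← hab]
    gcongr <;> split_ifs <;> nlinarith

theorem solvableInXPTime_lpLoss {p : ℝ} (hp : 0 ≤ p) (hp1 : p < 1) :
    SolvableInXPTime (lpLoss p) := by
  rcases hp.eq_or_lt with rfl | hp
  · refine solvableInXPTime_of_concave concaveOn_ite_zero_one (fun t _ => ?_) fun yhat y => ?_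
    · split_ifs <;> norm_num
    · simp [lpLoss, sub_eq_zero]
  · refine solvableInXPTime_of_concave (Real.concaveOn_rpow hp.le hp1.le)
      (fun t ht => Real.rpow_nonneg ht p) fun yhat y => ?_
    simp [lpLoss, hp.ne']

end ReLUTraining

theorem theorem4 :
    (∀ (L : ℝ → ℝ → ℝ) (ell : ℝ → ℝ),
      ConcaveOn ℝ (Set.Ici 0) ell → (∀ t, 0 ≤ t → 0 ≤ ell t) →
      (∀ yhat y, L yhat y = ell |yhat - y|) →
      ReLUTraining.SolvableInXPTime L) ∧
    (∀ p : ℝ, 0 ≤ p → p < 1 → ReLUTraining.SolvableInXPTime (ReLUTraining.lpLoss p)) :=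
  ⟨fun _ _ hell hpos hL => ReLUTraining.solvableInXPTime_of_concave hell hpos hL,
    fun _ hp hp1 => ReLUTraining.solvableInXPTime_lpLoss hp hp1⟩
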